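/- Let $\varphi\colon(R,\mathfrak m,k)\to(S,\mathfrak n,l)$ be a local homomorphism of commutative Noetherian local rings, and put $\operatorname{edim}\varphi=\operatorname{edim}(S/\mathfrak mS)$. Complexes have lower gradings. $\mathsf D^f_+(S)$ (respectively $\mathsf D^f_-(S)$) consists of the complexes $X$ of $S$-modules such that $H_n(X)$ is finitely generated for every $n$ and zero for $n\ll0$ (respectively $n\gg0$). For a finite family $\boldsymbol x$ in $S$, $K[\boldsymbol x;X]=K[\boldsymbol x;S]\otimes_SX$ is the Koszul complex, and $K^X=K[\boldsymbol x;X]$ when $\boldsymbol x$ is a minimal generating set of $\mathfrak n$. Let $\boldsymbol y$ be $\operatorname{edim}\varphi$ elements of $S$ whose images generate $\mathfrak n/\mathfrak mS$. For $X\in\mathsf D^f_+(S)$ and $Y\in\mathsf D^f_-(S)$ the Betti numbers of $X$ and the Bass numbers of $Y$ over $\varphi$ are $$\beta_n^\varphi(X)=\operatorname{rank}_l\operatorname{Tor}^R_n(k,K[\boldsymbol y;X]),\qquad \mu^n_\varphi(Y)=\operatorname{rank}_l\operatorname{Ext}_R^{\,n-\operatorname{edim}\varphi}(k,K[\boldsymbol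 y;Y])\qquad(n\in\mathbb Z),$$ and $P^\varphi_X(t)=\sum_n\beta^\varphi_n(X)t^n$, $I_\varphi^Y(t)=\sum_n\mu_\varphi^n(Y)t^n$ are the Poincaré and Bass series. For a sequence $(a_n)$ of nonnegative integers, its curvature is $\limsup_{n\to\infty}\sqrt[n]{a_n}\in[0,\infty]$, and its complexity is the infimum in $\mathbb N\cup\{\infty\}$ of the $d\in\mathbb N$ such that, for some $c\in\mathbb R$, $a_n\le c\,n^{d-1}$ for all $n\gg0$. Let $\operatorname{curv}_\varphi X$, $\operatorname{cx}_\varphi X$ be those of $(\beta_n^\varphi(X))$, and $\operatorname{inj\,curv}_\varphi Y$, $\operatorname{inj\,cx}_\varphi Y$ those of $(\mu^n_\varphi(Y))$. **Proposition.** Let $E$ be an injective hull of $l$ over $S$, let $M\in\mathsf D^f_-(S)$, and let $N=\operatorname{Hom}_S(K^M,E)$. Then $N\in\mathsf D^f_+(S)$; the modules $\operatorname{Tor}^R_n(k,K[\boldsymbol y;N])$ and $\operatorname{Ext}_R^n(k,K[\boldsymbol y;M])$ are finite-dimensional $l$-vector spaces, zero for $n\ll0$; as formal Laurent series $$P^\varphi_N(t)=I_\varphi^M(t)\cdot(1+t^{-1})^{\operatorname{edim}S},\qquad\text{i.e.}\qquad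 t^{\operatorname{edim}S}P^\varphi_N(t)=I_\varphi^M(t)\,(1+t)^{\operatorname{edim}S};$$ and $$\operatorname{curv}_\varphi N=\operatorname{inj\,curv}_\varphi M,\qquad \operatorname{cx}_\varphi N=\operatorname{inj\,cx}_\varphi M .$$ All this holds for every choice of the minimal generating set of $\mathfrak n$ and for all choices, possibly different for $N$ and for $M$, of $\boldsymbol y$. -/

import Mathlib

open CategoryTheory
open scoped TensorProduct ENNReal

universe u

namespace LocalHomInvariants

/-!
Complexes are objects of `CochainComplex (ModuleCat S) ℤ`.  A complex `M` with lower grading is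
the same thing as a cochain complex through `M_n = M^{-n}`; in particular `H_n(M) = H^{-n}(M)`.
-/

section Complexes

variable {S : Type u} [CommRing S]

/-- The homology module `H_n(M)`, in lower grading. -/
noncomputable abbrev lowerHomology (M : CochainComplex (ModuleCat.{u} S) ℤ) (n : ℤ) :
    ModuleCat.{u} S :=
  M.homology (-n)

/-- `M` lies in `D₊^f(S)`: each `H_n(M)` is finitely generated and `H_n(M) = 0` for `n ≪ 0`. -/
def InDPlus (M : CochainComplex (ModuleCat.{u} S) ℤ) : Prop :=
  (∀ n, Module.Finite S (lowerHomology M n)) ∧ ∃ b : ℤ, ∀ n < b, Subsingleton (lowerHomology M n)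

/-- `M` lies in `D₋^f(S)`: each `H_n(M)` is finitely generated and `H_n(M) = 0` for `n ≫ 0`. -/
def InDMinus (M : CochainComplex (ModuleCat.{u} S) ℤ) : Prop :=
  (∀ n, Module.Finite S (lowerHomology M n)) ∧ ∃ b : ℤ, ∀ n > b, Subsingleton (lowerHomology M n)

/-- The Koszul complex `K[x₁, …, xₑ; M] = K[x₁; S] ⊗ ⋯ ⊗ K[xₑ; S] ⊗ M` of a list of elements.
For one element, `K[x; S]` is the complex `S --x--> S` in lower degrees `1` and `0`, and
`K[x; S] ⊗ M` is the mapping cone of the homothety `x : M → M`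
(`(a, b) ↦ (-d a, x a + d b)` on `M_{n-1} ⊕ M_n`). -/
noncomputable def koszulList (M : CochainComplex (ModuleCat.{u} S) ℤ) :
    List S → CochainComplex (ModuleCat.{u} S) ℤ
  | [] => M
  | x :: xs => CochainComplex.mappingCone (x • 𝟙 (koszulList M xs))

/-- The Koszul complex `K[x; M] = K[x; S] ⊗_S M` of a finite family `x` of elements of `S`. -/
noncomputable def koszul {e : ℕ} (x : Fin e → S) (M : CochainComplex (ModuleCat.{u} S) ℤ) :
    CochainComplex (ModuleCat.{u} S) ℤ :=
  koszulList M (List.ofFn x)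

/-- The complex of `S`-modules `Hom_S(F, G)`; its component of upper degree `n` is
`∏_p Hom_S(F^p, G^{p+n})`, with differential `f ↦ d ∘ f - (-1)^n f ∘ d`. -/
noncomputable def homComplex (F G : CochainComplex (ModuleCat.{u} S) ℤ) :
    CochainComplex (ModuleCat.{u} S) ℤ where
  X n := ModuleCat.of S (CochainComplex.HomComplex.Cochain F G n)
  d n m := ModuleCat.ofHom (CochainComplex.HomComplex.δ_hom S F G n m)
  shape n m h := by
    apply ModuleCat.hom_ext
    apply LinearMap.ext
    intro f
    exact CochainComplex.HomComplex.δ_shape n m h f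
  d_comp_d' n m p _ _ := by
    apply ModuleCat.hom_ext
    apply LinearMap.ext
    intro f
    exact CochainComplex.HomComplex.δ_δ n m p f

/-- The complex `Hom_S(K, E)` for an `S`-module `E`: its component of lower degree `n` is
`Hom_S(K_{-n}, E)`, with differential `f ↦ -(-1)^n f ∘ d`. -/
noncomputable def homToModule (K : CochainComplex (ModuleCat.{u} S) ℤ)
    (E : Type u) [AddCommGroup E] [Module S E] : CochainComplex (ModuleCat.{u} S) ℤ where
  X n := ModuleCat.of S (K.X (-n) →ₗ[S] E)
  d n m := ModuleCat.ofHom (m.negOnePow • LinearMap.lcomp S E (K.d (-m) (-n)).hom)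
  shape n m h := by
    have h' : ¬ (ComplexShape.up ℤ).Rel (-m) (-n) := by
      simp only [ComplexShape.up_Rel] at h ⊢
      omega
    rw [K.shape _ _ h']
    apply ModuleCat.hom_ext
    apply LinearMap.ext
    intro f
    apply LinearMap.ext
    intro a
    change m.negOnePow • f 0 = 0
    rw [map_zero, smul_zero]
  d_comp_d' n m p _ _ := by
    apply ModuleCat.hom_ext
    apply LinearMap.ext
    intro f
    apply LinearMap.ext
    intro a
    change p.negOnePow • m.negOnePow • f ((K.d (-p) (-m) ≫ K.d (-m) (-n)).hom a) = 0
    rw [K.d_comp_d, ModuleCat.hom_zero, LinearMap.zero_apply, map_zero, smul_zero, smul_zero]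

end Complexes

section Derived

variable {R S : Type u} [CommRing R] [CommRing S] (φ : R →+* S)

/-- For a projective resolution `P` of the `R`-module `L`, the complex `S ⊗_R P` of
projective `S`-modules. -/
noncomputable def baseChangeResolution (L : Type u) [AddCommGroup L] [Module R L] :
    CochainComplex (ModuleCat.{u} S) ℤ :=
  ((ModuleCat.extendScalars.{u, u, u} φ).mapHomologicalComplex (ComplexShape.up ℤ)).obj
    (projectiveResolution (ModuleCat.of R L)).cochainComplex

/-- `Tor_n^R(L, X)` for an `R`-module `L` and a complex `X` of `S`-modules, with its `S`-module
structure induced from `X`: the homology of `P ⊗_R X = (S ⊗_R P) ⊗_S X`, where `P` is a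
projective resolution of `L` over `R`. -/
noncomputable def torModule (L : Type u) [AddCommGroup L] [Module R L]
    (X : CochainComplex (ModuleCat.{u} S) ℤ) (n : ℤ) : ModuleCat.{u} S :=
  lowerHomology (HomologicalComplex.tensorObj (baseChangeResolution φ L) X) n

/-- `Ext^n_R(L, X) = H_{-n}(RHom_R(L, X))` for an `R`-module `L` and a complex `X` of
`S`-modules, with its `S`-module structure induced from `X`: the cohomology of
`Hom_R(P, X) = Hom_S(S ⊗_R P, X)`, where `P` is a projective resolution of `L` over `R`. -/
noncomputable def extModule (L : Type u) [AddCommGroup L] [Module R L]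
    (X : CochainComplex (ModuleCat.{u} S) ℤ) (n : ℤ) : ModuleCat.{u} S :=
  lowerHomology (homComplex (baseChangeResolution φ L) X) (-n)

end Derived

section Local

variable {S : Type u} [CommRing S] [IsLocalRing S]

variable (S) in
/-- The embedding dimension: the minimal number of generators of the maximal ideal. -/
noncomputable def edim : ℕ := (IsLocalRing.maximalIdeal S).spanFinrank

/-- `x` is a minimal generating family of the maximal ideal of `S`. -/
def IsMinimalGenerating (x : Fin (edim S) → S) : Prop :=
  Ideal.span (Set.range x) = IsLocalRing.maximalIdeal S

/-- `V` is a finite-dimensional vector space over the residue field `l` of `S`: it is finitely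
generated over `S` and annihilated by the maximal ideal. -/
def IsFiniteResidueSpace (V : Type u) [AddCommGroup V] [Module S V] : Prop :=
  Module.Finite S V ∧ IsLocalRing.maximalIdeal S ≤ Module.annihilator S V

/-- The rank over the residue field `l` of `S` of an `S`-module `V` annihilated by the maximal
ideal (so that `V = l ⊗_S V`). -/
noncomputable def residueRank (V : Type u) [AddCommGroup V] [Module S V] : ℕ :=
  Module.finrank (IsLocalRing.ResidueField S) (IsLocalRing.ResidueField S ⊗[S] V)

/-- The `S`-linear map `ι : l → E` is an injective hull of the residue field `l`: the module `E`
is injective and `ι` is an essential monomorphism. -/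
structure IsInjectiveHull {E : Type u} [AddCommGroup E] [Module S E]
    (ι : IsLocalRing.ResidueField S →ₗ[S] E) : Prop where
  injective_module : Module.Injective S E
  injective_map : Function.Injective ι
  essential : ∀ N : Submodule S E, N ⊓ LinearMap.range ι = ⊥ → N = ⊥

end Local

section LocalHom

variable {R S : Type u} [CommRing R] [CommRing S] [IsLocalRing R] [IsLocalRing S]
  (φ : R →+* S)

/-- The ideal `𝔪S` of `S` generated by the image of the maximal ideal of `R`. -/
def extendedIdeal : Ideal S := (IsLocalRing.maximalIdeal R).map φ

/-- The closed fibre `S/𝔪S` of a local homomorphism is a local ring. -/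
instance isLocalRing_fibre [IsLocalHom φ] : IsLocalRing (S ⧸ extendedIdeal φ) := by
  have : Nontrivial (S ⧸ extendedIdeal φ) :=
    Ideal.Quotient.nontrivial_iff.mpr (IsLocalRing.map_maximalIdeal_lt_top φ).ne
  exact IsLocalRing.of_surjective' (Ideal.Quotient.mk _) Ideal.Quotient.mk_surjective

variable [IsLocalHom φ]

/-- The embedding dimension of a local homomorphism, `edim φ = edim (S/𝔪S)`. -/
noncomputable def edimHom : ℕ := edim (S ⧸ extendedIdeal φ)

/-- `y` is a minimal set of generators of `𝔫` modulo `𝔪S`: it has `edim φ` elements and its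
image in `S/𝔪S` generates the maximal ideal `𝔫/𝔪S`. -/
def IsMinimalGeneratingMod (y : Fin (edimHom φ) → S) : Prop :=
  IsMinimalGenerating (S := S ⧸ extendedIdeal φ) fun i => Ideal.Quotient.mk (extendedIdeal φ) (y i)

/-- The module `Tor_n^R(k, K[y; M])`, whose rank over `l` is the `n`-th Betti number. -/
noncomputable def bettiModule (y : Fin (edimHom φ) → S) (M : CochainComplex (ModuleCat.{u} S) ℤ)
    (n : ℤ) : ModuleCat.{u} S :=
  torModule φ (IsLocalRing.ResidueField R) (koszul y M) n

/-- The `n`-th Betti number of `M` over `φ`, computed with `y`. -/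
noncomputable def betti (y : Fin (edimHom φ) → S) (M : CochainComplex (ModuleCat.{u} S) ℤ)
    (n : ℤ) : ℕ :=
  residueRank (S := S) (bettiModule φ y M n)

/-- The module `Ext^{n - edim φ}_R(k, K[y; M])`, whose rank over `l` is the `n`-th Bass number. -/
noncomputable def bassModule (y : Fin (edimHom φ) → S) (M : CochainComplex (ModuleCat.{u} S) ℤ)
    (n : ℤ) : ModuleCat.{u} S :=
  extModule φ (IsLocalRing.ResidueField R) (koszul y M) (n - edimHom φ)

/-- The `n`-th Bass number of `M` over `φ`, computed with `y`. -/
noncomputable def bass (y : Fin (edimHom φ) → S) (M : CochainComplex (ModuleCat.{u} S) ℤ)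
    (n : ℤ) : ℕ :=
  residueRank (S := S) (bassModule φ y M n)

end LocalHom

section Series

/-- The formal Laurent series `∑ aₙ tⁿ` of a family of natural numbers with `aₙ = 0` for
`n ≪ 0`. -/
noncomputable def laurent (a : ℤ → ℕ) (h : BddBelow (Function.support a)) : LaurentSeries ℤ :=
  HahnSeries.ofSuppBddBelow (fun n => (a n : ℤ))
    (h.mono fun n hn => by simpa [Function.mem_support] using hn)

/-- The curvature `limsup_n (aₙ)^{1/n}`, in `[0, ∞]`. -/
noncomputable def curv (a : ℤ → ℕ) : ℝ≥0∞ :=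
  Filter.limsup (fun n : ℕ => ((a n : ℝ≥0∞)) ^ (1 / (n : ℝ))) Filter.atTop

/-- The complexity: the least natural number `d` such that, for some real `c`, one has
`aₙ ≤ c n^{d-1}` for all `n ≫ 0`; it is `∞` if there is no such `d`. -/
noncomputable def cx (a : ℤ → ℕ) : ℕ∞ :=
  ⨅ d ∈ {d : ℕ | ∃ c : ℝ, ∀ᶠ n : ℕ in Filter.atTop, (a n : ℝ) ≤ c * (n : ℝ) ^ ((d : ℤ) - 1)},
    (d : ℕ∞)

end Series

end LocalHomInvariants

/-! Write `Z = K[x; M]`, so that `N = Hom(Z, E)`, and let `a_n` be the length of `Ext^n_R(k, Z)`.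
Every quantity is reduced to `a` by one mechanism. If `s` acts as zero on `Ext_R(k, X)`, then the
long exact sequence of the cone of `s : X → X` breaks into short exact sequences, and lengths change
from `a_n` to `a_n + a_{n+1}`. This operation is `stepSum`; on series it is multiplication by `1 +
t⁻¹`. A Koszul complex is an iterated cone, so only the number of elements matters. This is why `y`
and `z` may be chosen independently.

Annihilation has two sources: `𝔪` acts as zero through `k`, and the elements of a Koszul complex act
null-homotopically on it (`homotopyAnnihilator`). Hence `𝔫` kills `Ext_R(k, K[z; M])`, since `𝔫` is
contained in `𝔪S + (z)`, and it kills every `Ext` into complexes built from `Z`.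

Betti side (`bettiModule_homToModule`): `Hom(Tor_n(k, K[y; N]), E)` is `Ext^n(k, Hom(K[y; N], E))`,
because `E` is injective and by tensor-hom adjunction. The dual of a cone of a homothety is a cocone
(`homToModuleMappingConeIso`), and `Hom(N, E)` is quasi-isomorphic to `Z` (`biduality_quasiIso`). No
completeness of `S` is needed, as the homology of `Z` consists of finite-dimensional `l`-spaces. So
the `n`-th Betti number is `stepSum^[edim φ] a (n - edim φ)`.

Bass side: `K[z; K[x; M]]` and `K[x; K[z; M]]` are isomorphic (`nonempty_koszul_koszul_iso`).
Computing `Ext(k, -)` in both orders shows that `stepSum^[edim φ] a` equals `stepSum^[edim S]` of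
the ranks of `Ext(k, K[z; M])`. After the shift by `edim φ`, the Betti sequence is therefore
`stepSum^[edim S]` of the Bass sequence. This is the identity of series, and `stepSum` changes
neither curvature nor complexity. -/

namespace LocalHomInvariants

/-! ### Sequences: the effect of multiplication by `1 + t⁻¹` on series, curvature and complexity -/

section Numeric

/-- The family with `n`-th term `a n + a (n + 1)`; on series, multiplication by `1 + t⁻¹`. -/
def stepSum {A : Type*} [Add A] (a : ℤ → A) : ℤ → A := fun n => a n + a (n + 1)

lemma support_bddBelow_of_forall_lt {a : ℤ → ℕ} {b : ℤ} (h : ∀ n < b, a n = 0) :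
    BddBelow (Function.support a) :=
  ⟨b, fun n hn => by
    by_contra! hlt
    exact hn (h n hlt)⟩

lemma bddBelow_support_stepSum {a : ℤ → ℕ} (h : BddBelow (Function.support a)) :
    BddBelow (Function.support (stepSum a)) := by
  obtain ⟨b, hb⟩ := h
  have h0 : ∀ n < b, a n = 0 := fun n hn => by
    by_contra hne
    exact absurd (hb hne) (not_le.mpr hn)
  refine support_bddBelow_of_forall_lt (b := b - 1) fun n hn => ?_
  simp [stepSum, h0 n (by omega), h0 (n + 1) (by omega)]

lemma laurent_stepSum {a : ℤ → ℕ} (h : BddBelow (Function.support a))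
    (h' : BddBelow (Function.support (stepSum a))) :
    laurent (stepSum a) h' = laurent a h * (1 + HahnSeries.single (-1 : ℤ) (1 : ℤ)) := by
  ext n
  have := HahnSeries.coeff_mul_single_add (r := (1 : ℤ)) (x := laurent a h) (a := n + 1) (b := -1)
  rw [mul_add, mul_one, HahnSeries.coeff_add]
  rw [show n + 1 + -1 = n by ring] at this
  rw [this]
  simp [laurent, stepSum]

lemma laurent_stepSum_iterate (e : ℕ) {a : ℤ → ℕ} (h : BddBelow (Function.support a)) :
    ∃ h' : BddBelow (Function.support (stepSum^[e] a)),
      laurent (stepSum^[e] a) h' =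
        laurent a h * (1 + HahnSeries.single (-1 : ℤ) (1 : ℤ)) ^ e := by
  induction e with
  | zero => exact ⟨h, by simp⟩
  | succ e ih =>
    obtain ⟨h', ih⟩ := ih
    simp only [Function.iterate_succ', Function.comp_apply]
    exact ⟨bddBelow_support_stepSum h', by rw [laurent_stepSum h', ih, pow_succ, mul_assoc]⟩

lemma curv_mono {a b : ℤ → ℕ} (h : ∀ n, a n ≤ b n) : curv a ≤ curv b := by
  refine Filter.limsup_le_limsup (Filter.Eventually.of_forall fun n => ?_)
  exact ENNReal.rpow_le_rpow (by exact_mod_cast h n) (by positivity)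

/-- For `curv a < r < r'` one has `a_n ≤ r^n` eventually, so the sum is at most `(1 + r) r^n`; the
gap between `r` and `r'` absorbs the constant factor. -/
lemma curv_stepSum (a : ℤ → ℕ) : curv (stepSum a) = curv a := by
  refine le_antisymm ?_ (curv_mono fun n => Nat.le_add_right _ _)
  refine le_of_forall_gt fun c hc => ?_
  obtain ⟨r, hr, hrc⟩ := exists_between hc
  obtain ⟨r', hr', hrc'⟩ := exists_between hrc
  lift r to NNReal using ne_top_of_lt hr'
  lift r' to NNReal using ne_top_of_lt hrc'
  refine lt_of_le_of_lt ?_ hrc'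
  have hrr : r < r' := by exact_mod_cast hr'
  have hr0 : 0 < r := by
    have := lt_of_le_of_lt (zero_le : (0 : ℝ≥0∞) ≤ curv a) hr
    exact_mod_cast this
  have h1 : ∀ᶠ n : ℕ in Filter.atTop, (a n : ℝ≥0∞) ≤ (r : ℝ≥0∞) ^ n := by
    filter_upwards [Filter.eventually_lt_of_limsup_lt hr, Filter.eventually_gt_atTop 0]
      with n hn hn0
    have h := ENNReal.rpow_le_rpow hn.le (z := (n : ℝ)) (by positivity)
    rwa [← ENNReal.rpow_mul, one_div, inv_mul_cancel₀ (by positivity), ENNReal.rpow_one,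
      ENNReal.rpow_natCast] at h
  have h2 : ∀ᶠ n : ℕ in Filter.atTop, 1 + r ≤ (r' / r) ^ n :=
    (tendsto_pow_atTop_atTop_of_one_lt ((one_lt_div hr0).mpr hrr)).eventually_ge_atTop _
  refine Filter.limsup_le_of_le (by isBoundedDefault) ?_
  filter_upwards [h1, (Filter.tendsto_add_atTop_nat 1).eventually h1, h2,
    Filter.eventually_gt_atTop 0] with n ha hb hc hn0
  have h3 : ((stepSum a n : ℕ) : ℝ≥0∞) ≤ (r' : ℝ≥0∞) ^ n := by
    calc ((stepSum a n : ℕ) : ℝ≥0∞) = (a n : ℝ≥0∞) + (a ((n + 1 : ℕ) : ℤ) : ℝ≥0∞) := by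
          simp [stepSum]
      _ ≤ (r : ℝ≥0∞) ^ n + (r : ℝ≥0∞) ^ (n + 1) := add_le_add ha hb
      _ = (((1 + r) * r ^ n : NNReal) : ℝ≥0∞) := by push_cast; ring
      _ ≤ ((r' ^ n : NNReal) : ℝ≥0∞) := by
          rw [ENNReal.coe_le_coe]
          calc (1 + r) * r ^ n ≤ (r' / r) ^ n * r ^ n := by gcongr
            _ = r' ^ n := by rw [← mul_pow, div_mul_cancel₀ _ hr0.ne']
      _ = _ := by push_cast; rfl
  calc ((stepSum a n : ℕ) : ℝ≥0∞) ^ (1 / (n : ℝ)) ≤ ((r' : ℝ≥0∞) ^ n) ^ (1 / (n : ℝ)) :=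
        ENNReal.rpow_le_rpow h3 (by positivity)
    _ = r' := by
        rw [← ENNReal.rpow_natCast, ← ENNReal.rpow_mul, one_div,
          mul_inv_cancel₀ (by positivity), ENNReal.rpow_one]

lemma cx_stepSum (a : ℤ → ℕ) : cx (stepSum a) = cx a := by
  unfold cx
  congr! 4
  ext d
  simp only [Set.mem_ofPred_eq]
  constructor
  · rintro ⟨c, hc⟩
    refine ⟨c, hc.mono fun n hn => le_trans ?_ hn⟩
    simp [stepSum]
  · rintro ⟨c, hc⟩
    -- The two terms bound `a_n` and `a_{n+1}`, using `(n+1)^(d-1) ≤ 2^d n^(d-1)` for `n ≥ 1`. The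
    -- case `d = 0`, with exponent `-1`, is separate; the absolute value is there because `c` may be
    -- negative.
    refine ⟨|c| + |c| * 2 ^ d, ?_⟩
    filter_upwards [hc, (Filter.tendsto_add_atTop_nat 1).eventually hc,
      Filter.eventually_gt_atTop 0] with n h1 h2 hn
    have hn' : (1 : ℝ) ≤ n := by exact_mod_cast hn
    have h3 : ((n + 1 : ℕ) : ℝ) ^ ((d : ℤ) - 1) ≤ 2 ^ d * (n : ℝ) ^ ((d : ℤ) - 1) := by
      rcases d with _ | d
      · simp only [Nat.cast_zero, zero_sub, zpow_neg_one, pow_zero, one_mul]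
        gcongr
        simp
      · simp only [Nat.cast_add, Nat.cast_one, add_sub_cancel_right, zpow_natCast]
        calc ((n : ℝ) + 1) ^ d ≤ (2 * n) ^ d := by gcongr; linarith
          _ = 2 ^ d * (n : ℝ) ^ d := mul_pow _ _ _
          _ ≤ 2 ^ (d + 1) * (n : ℝ) ^ d := by gcongr <;> simp
    have e1 : ((stepSum a n : ℕ) : ℝ) = a n + a ((n + 1 : ℕ) : ℤ) := by simp [stepSum]
    rw [e1, add_mul]
    refine add_le_add (h1.trans ?_) (h2.trans ?_)
    · gcongr
      exact le_abs_self c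
    · calc c * ((n + 1 : ℕ) : ℝ) ^ ((d : ℤ) - 1) ≤ |c| * ((n + 1 : ℕ) : ℝ) ^ ((d : ℤ) - 1) := by
            gcongr
            exact le_abs_self c
        _ ≤ |c| * (2 ^ d * (n : ℝ) ^ ((d : ℤ) - 1)) := by gcongr
        _ = _ := by ring

lemma curv_stepSum_iterate (e : ℕ) (a : ℤ → ℕ) : curv (stepSum^[e] a) = curv a := by
  induction e with
  | zero => rfl
  | succ e ih => rw [Function.iterate_succ_apply', curv_stepSum, ih]

lemma cx_stepSum_iterate (e : ℕ) (a : ℤ → ℕ) : cx (stepSum^[e] a) = cx a := by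
  induction e with
  | zero => rfl
  | succ e ih => rw [Function.iterate_succ_apply', cx_stepSum, ih]

end Numeric

/-! ### Vector spaces over the residue field and their duals into `E` -/

section ResidueSpaces

variable {S : Type u} [CommRing S] [IsLocalRing S]

open IsLocalRing

lemma exists_linearEquiv_finsupp_residueField (V : Type u) [AddCommGroup V] [Module S V]
    (hV : maximalIdeal S ≤ Module.annihilator S V) :
    ∃ I : Type u, Nonempty (V ≃ₗ[S] (I →₀ ResidueField S)) := by
  have ht : Module.IsTorsionBySet S V (maximalIdeal S) := fun v s =>
    (Module.mem_annihilator.mp (hV s.2)) v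
  let _ : Module (ResidueField S) V := ht.module
  have : IsScalarTower S (ResidueField S) V := ht.isScalarTower
  exact ⟨_, ⟨(Module.Basis.ofVectorSpace (ResidueField S) V).repr.restrictScalars S⟩⟩

/-- Allows ranks over `l` to be replaced by lengths over `S`, which are additive on exact sequences
and require no choice of an `l`-structure. -/
lemma residueRank_eq_length (V : Type u) [AddCommGroup V] [Module S V]
    (hV : maximalIdeal S ≤ Module.annihilator S V) :
    residueRank (S := S) V = (Module.length S V).toNat := by
  have h1 : Module.length S (ResidueField S ⊗[S] V) = Module.length S V := by
    have e := TensorProduct.quotTensorEquivQuotSMul V (maximalIdeal S)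
    have h0 : maximalIdeal S • (⊤ : Submodule S V) = ⊥ := by
      rw [eq_bot_iff, Submodule.smul_le]
      intro r hr v _
      exact (Module.mem_annihilator.mp (hV hr)) v
    exact (e.trans (Submodule.quotEquivOfEqBot _ h0)).length_eq
  have h2 := Module.length_eq_of_surjective (R := ResidueField S) (S := S)
    (M := ResidueField S ⊗[S] V) (IsLocalRing.residue_surjective)
  rw [residueRank, Module.finrank, ← h1, h2, Module.length_eq_rank]
  rfl

lemma length_ne_top_of_isFiniteResidueSpace [IsNoetherianRing S] {V : Type u} [AddCommGroup V]
    [Module S V] (hV : IsFiniteResidueSpace (S := S) V) : Module.length S V ≠ ⊤ := by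
  obtain ⟨hf, hk⟩ := hV
  obtain ⟨I, ⟨e⟩⟩ := exists_linearEquiv_finsupp_residueField V hk
  have ht : Module.IsTorsionBySet S V (maximalIdeal S) := fun v s =>
    (Module.mem_annihilator.mp (hk s.2)) v
  let _ : Module (ResidueField S) V := ht.module
  have : IsScalarTower S (ResidueField S) V := ht.isScalarTower
  have : Module.Finite (ResidueField S) V := Module.Finite.of_restrictScalars_finite S _ _
  rw [Module.length_eq_of_surjective (R := ResidueField S) (S := S)
    (IsLocalRing.residue_surjective), Module.length_eq_finrank]
  exact ENat.natCast_ne_top _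

variable {E : Type u} [AddCommGroup E] [Module S E] {ι : ResidueField S →ₗ[S] E}

/-- The socle of `E` is the image of `l`: if `𝔫 e = 0` and `e` lies outside the image, the line `S
e` meets the image trivially, and essentiality forces `e = 0`. -/
lemma mem_range_of_forall_smul_eq_zero (hE : IsInjectiveHull ι) {e : E}
    (he : ∀ s ∈ maximalIdeal S, s • e = 0) : e ∈ LinearMap.range ι := by
  by_contra hne
  have h := hE.essential (Submodule.span S {e}) (by
    rw [eq_bot_iff]
    rintro a ⟨ha, ha'⟩
    obtain ⟨s, rfl⟩ := Submodule.mem_span_singleton.mp ha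
    by_cases hs : s ∈ maximalIdeal S
    · simp [he s hs]
    · have hu : IsUnit s := by simpa using hs
      obtain ⟨t, rfl⟩ := hu
      refine absurd ?_ hne
      have := (LinearMap.range ι).smul_mem (↑t⁻¹ : S) ha'
      simpa [smul_smul] using this)
  have h0 : e = 0 := by
    simpa using (Submodule.eq_bot_iff _).mp h e (Submodule.mem_span_singleton_self e)
  exact hne (h0 ▸ Submodule.zero_mem _)

/-- The dual of the residue field with respect to its injective hull is the residue field. -/
noncomputable def residueFieldDual (hE : IsInjectiveHull ι) :
    ResidueField S ≃ₗ[S] (ResidueField S →ₗ[S] E) :=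
  LinearEquiv.ofBijective
    { toFun := fun a => ι ∘ₗ LinearMap.mul S (ResidueField S) a
      map_add' := fun a b => by ext; simp
      map_smul' := fun s a => by ext; simp }
    ⟨fun a b h => by
      have := LinearMap.congr_fun h 1
      simpa using hE.injective_map (by simpa using this), fun f => by
      obtain ⟨a, ha⟩ := mem_range_of_forall_smul_eq_zero hE (e := f 1) (fun s hs => by
        rw [← map_smul]
        have : s • (1 : ResidueField S) = 0 := by
          rw [Algebra.smul_def, mul_one]
          exact (residue_eq_zero_iff s).mpr hs
        rw [this, map_zero])
      refine ⟨a, LinearMap.ext fun b => ?_⟩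
      obtain ⟨s, rfl⟩ := residue_surjective b
      have : residue S s = s • (1 : ResidueField S) := by
        rw [Algebra.smul_def, mul_one]; rfl
      rw [this, map_smul, map_smul, ← ha]
      simp⟩

/-- The same index set `I` serves `V = l^(I)` and its dual `l^I`, and `I` may be infinite;
finiteness can then be passed in either direction. -/
lemma exists_dual_linearEquiv (hE : IsInjectiveHull ι) {V : Type u} [AddCommGroup V] [Module S V]
    (hV : maximalIdeal S ≤ Module.annihilator S V) :
    ∃ I : Type u, Nonempty (V ≃ₗ[S] (I →₀ ResidueField S)) ∧
      Nonempty ((V →ₗ[S] E) ≃ₗ[S] (I → ResidueField S)) := by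
  obtain ⟨I, ⟨e⟩⟩ := exists_linearEquiv_finsupp_residueField V hV
  refine ⟨I, ⟨e⟩, ⟨?_⟩⟩
  have e1 : (V →ₗ[S] E) ≃ₗ[S] ((I →₀ ResidueField S) →ₗ[S] E) :=
    LinearEquiv.arrowCongr e (LinearEquiv.refl S E)
  have e2 : (I → (ResidueField S →ₗ[S] E)) ≃ₗ[S] ((I →₀ ResidueField S) →ₗ[S] E) :=
    Finsupp.lsum S
  have e3 : (I → (ResidueField S →ₗ[S] E)) ≃ₗ[S] (I → ResidueField S) :=
    LinearEquiv.piCongrRight fun _ => (residueFieldDual hE).symm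
  exact e1.trans (e2.symm.trans e3)

/-- The dual is `l^I`, the linear dual of `l^(I)`, and a vector space with finite-dimensional dual
is finite-dimensional. It is used for Tor, which is accessible only through its dual. -/
lemma finite_of_finite_dual (hE : IsInjectiveHull ι) {V : Type u} [AddCommGroup V] [Module S V]
    (hV : maximalIdeal S ≤ Module.annihilator S V) (h : Module.Finite S (V →ₗ[S] E)) :
    Module.Finite S V := by
  obtain ⟨I, ⟨e⟩, ⟨e'⟩⟩ := exists_dual_linearEquiv hE hV
  have h1 : Module.Finite S (I → ResidueField S) := Module.Finite.equiv e'
  have h2 : Module.Finite (ResidueField S) (I → ResidueField S) :=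
    Module.Finite.of_restrictScalars_finite S _ _
  have h3 : Module.Finite (ResidueField S) (Module.Dual (ResidueField S) (I →₀ ResidueField S)) :=
    Module.Finite.equiv (Finsupp.lsum (ResidueField S) (R := ResidueField S) (α := I)
      (M := ResidueField S) (N := ResidueField S) |>.symm.trans
        (LinearEquiv.piCongrRight fun _ => LinearMap.ringLmapEquivSelf _ _ _)).symm
  have h4 : Module.Finite (ResidueField S) (I →₀ ResidueField S) := by
    rwa [Module.finite_dual_iff] at h3
  have h5 : Module.Finite S (I →₀ ResidueField S) := Module.Finite.trans (ResidueField S) _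
  exact Module.Finite.equiv e.symm

lemma finite_dual (hE : IsInjectiveHull ι) {V : Type u} [AddCommGroup V] [Module S V]
    (hV : IsFiniteResidueSpace (S := S) V) :
    Module.length S (V →ₗ[S] E) = Module.length S V ∧
      IsFiniteResidueSpace (S := S) (V →ₗ[S] E) := by
  obtain ⟨hf, hk⟩ := hV
  obtain ⟨I, ⟨e⟩, ⟨e'⟩⟩ := exists_dual_linearEquiv hE hk
  have h1 : Module.Finite S (I →₀ ResidueField S) := Module.Finite.equiv e
  have h2 : Module.Finite (ResidueField S) (I →₀ ResidueField S) :=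
    Module.Finite.of_restrictScalars_finite S _ _
  have : Finite I := Module.finite_finsupp_self_iff.mp h2 |>.resolve_left (not_subsingleton _)
  have e2 := e'.trans ((Finsupp.linearEquivFunOnFinite S (ResidueField S) I).symm.trans e.symm)
  refine ⟨e2.length_eq, Module.Finite.equiv e2.symm, ?_⟩
  rw [e2.annihilator_eq]
  exact hk

/-- `E` is a cogenerator: `S a` is `S / ann a`, which maps onto `l` and so into `E` with `a` going
to a nonzero element; injectivity extends this map to `A`. -/
lemma exists_dual_apply_ne_zero (hE : IsInjectiveHull ι) {A : Type u} [AddCommGroup A] [Module S A]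
    {a : A} (ha : a ≠ 0) : ∃ f : A →ₗ[S] E, f a ≠ 0 := by
  have hI : LinearMap.ker (LinearMap.toSpanSingleton S A a) ≤ maximalIdeal S :=
    le_maximalIdeal fun h => ha (by
      have : (1 : S) ∈ LinearMap.ker (LinearMap.toSpanSingleton S A a) := h ▸ trivial
      simpa using this)
  let j : (S ⧸ LinearMap.ker (LinearMap.toSpanSingleton S A a)) →ₗ[S] A :=
    (LinearMap.ker (LinearMap.toSpanSingleton S A a)).liftQ _ le_rfl
  let q : (S ⧸ LinearMap.ker (LinearMap.toSpanSingleton S A a)) →ₗ[S] ResidueField S :=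
    Submodule.mapQ _ _ LinearMap.id hI
  have hj : Function.Injective j := by
    rw [← LinearMap.ker_eq_bot]
    exact Submodule.ker_liftQ_eq_bot _ _ _ le_rfl
  obtain ⟨f, hf⟩ := hE.injective_module.out j hj (ι ∘ₗ q)
  refine ⟨f, fun h0 => ?_⟩
  have h1 := hf (Submodule.Quotient.mk 1)
  have h2 : j (Submodule.Quotient.mk 1) = a := by
    change (LinearMap.ker (LinearMap.toSpanSingleton S A a)).liftQ _ le_rfl
      (Submodule.Quotient.mk 1) = a
    rw [Submodule.liftQ_apply, LinearMap.toSpanSingleton_apply, one_smul]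
  have h3 : q (Submodule.Quotient.mk 1) = 1 := rfl
  rw [h2, h0, LinearMap.comp_apply, h3] at h1
  exact one_ne_zero (hE.injective_map (h1.symm.trans (map_zero ι).symm))

end ResidueSpaces

/-! ### Homology of complexes of modules, and its compatibility with `Hom(-, E)` -/

section HomologyOfModules

variable {S : Type u} [CommRing S]

/-- The homology of a complex of modules, as cycles modulo boundaries. -/
noncomputable def homologyEquiv (K : CochainComplex (ModuleCat.{u} S) ℤ) {i j k : ℤ}
    (hij : i + 1 = j) (hjk : j + 1 = k) :
    K.homology j ≃ₗ[S] (LinearMap.ker (K.d j k).hom ⧸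
      (LinearMap.range (K.d i j).hom).submoduleOf (LinearMap.ker (K.d j k).hom)) :=
  ((ShortComplex.homologyMapIso (K.isoSc' i j k (by simp; omega) (by simp; omega))) ≪≫
    (K.sc' i j k).moduleCatHomologyIso).toLinearEquiv.trans
    (Submodule.quotEquivOfEq _ _ (by
      ext ⟨a, ha⟩
      constructor
      · rintro ⟨w, hw⟩
        exact ⟨w, congrArg Subtype.val hw⟩
      · rintro ⟨w, hw⟩
        exact ⟨w, Subtype.ext hw⟩))

lemma exists_cycles (K : CochainComplex (ModuleCat.{u} S) ℤ) (j k : ℤ)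
    (x : K.homology j) : ∃ c : K.cycles j, K.homologyπ j c = x ∧ K.d j k (K.iCycles j c) = 0 := by
  obtain ⟨c, rfl⟩ := (ModuleCat.epi_iff_surjective (K.homologyπ j)).mp inferInstance x
  refine ⟨c, rfl, ?_⟩
  rw [← ConcreteCategory.comp_apply, HomologicalComplex.iCycles_d]
  rfl

lemma shortComplex_homologyπ_eq_zero_iff (T : ShortComplex (ModuleCat.{u} S)) (c : T.cycles) :
    T.homologyπ c = 0 ↔ ∃ w, T.f w = T.iCycles c := by
  have h1 := ConcreteCategory.congr_hom T.π_moduleCatCyclesIso_hom c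
  have h2 := ConcreteCategory.congr_hom T.moduleCatCyclesIso_hom_i c
  rw [ConcreteCategory.comp_apply, ConcreteCategory.comp_apply] at h1
  rw [ConcreteCategory.comp_apply] at h2
  have h3 : T.homologyπ c = 0 ↔ T.moduleCatHomologyIso.hom (T.homologyπ c) = 0 := by
    constructor
    · intro h; rw [h, map_zero]
    · intro h
      exact (ModuleCat.mono_iff_injective T.moduleCatHomologyIso.hom).mp inferInstance
        (h.trans (map_zero _).symm)
  rw [h3, h1, ← h2]
  refine (Submodule.Quotient.mk_eq_zero _).trans ⟨?_, ?_⟩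
  · rintro ⟨w, hw⟩
    exact ⟨w, congrArg Subtype.val hw⟩
  · rintro ⟨w, hw⟩
    exact ⟨w, Subtype.ext hw⟩

lemma homologyπ_eq_zero_iff (K : CochainComplex (ModuleCat.{u} S) ℤ) {i j : ℤ} (hij : i + 1 = j)
    (c : K.cycles j) : K.homologyπ j c = 0 ↔ ∃ w : K.X i, K.d i j w = K.iCycles j c := by
  obtain rfl : (ComplexShape.up ℤ).prev j = i := by simp; omega
  exact shortComplex_homologyπ_eq_zero_iff (K.sc j) c

lemma homologyMap_injective {K L : CochainComplex (ModuleCat.{u} S) ℤ} (f : K ⟶ L) {i j : ℤ} (k : ℤ)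
    (hij : i + 1 = j)
    (h : ∀ z : K.X j, K.d j k z = 0 → ∀ w : L.X i, L.d i j w = f.f j z → ∃ v, K.d i j v = z) :
    Function.Injective (HomologicalComplex.homologyMap f j) := by
  rw [injective_iff_map_eq_zero]
  intro x hx
  obtain ⟨c, rfl, hc⟩ := exists_cycles K j k x
  rw [← ConcreteCategory.comp_apply, HomologicalComplex.homologyπ_naturality,
    ConcreteCategory.comp_apply, homologyπ_eq_zero_iff L hij] at hx
  obtain ⟨w, hw⟩ := hx
  rw [homologyπ_eq_zero_iff K hij]
  refine h _ hc w ?_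
  rw [hw, ← ConcreteCategory.comp_apply, HomologicalComplex.cyclesMap_i,
    ConcreteCategory.comp_apply]

/-- Additivity gives the cokernel length zero once the common length is cancelled, which requires it
to be finite. -/
lemma bijective_of_injective_of_length_eq {A B : Type u} [AddCommGroup A] [Module S A]
    [AddCommGroup B] [Module S B] (f : A →ₗ[S] B) (hf : Function.Injective f)
    (h : Module.length S A = Module.length S B) (hA : Module.length S A ≠ ⊤) :
    Function.Bijective f := by
  refine ⟨hf, ?_⟩
  have := Module.length_eq_add_of_exact f (LinearMap.range f).mkQ hf
    (Submodule.mkQ_surjective _) (LinearMap.exact_map_mkQ_range f)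
  rw [← h] at this
  have h0 : Module.length S (B ⧸ LinearMap.range f) = 0 := by
    have h1 : Module.length S A + 0 = Module.length S A + Module.length S (B ⧸ LinearMap.range f) := by
      simpa using this
    exact (ENat.add_right_injective_of_ne_top hA h1).symm
  rw [Module.length_eq_zero_iff] at h0
  rw [← LinearMap.range_eq_top]
  exact Submodule.Quotient.subsingleton_iff.mp h0

variable {E : Type u} [AddCommGroup E] [Module S E]

/-- For an injective module `E`, dualizing into `E` commutes with homology. -/
noncomputable def homologyDualEquiv (hE : Module.Injective S E) {A B C : Type u} [AddCommGroup A]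
    [Module S A] [AddCommGroup B] [Module S B] [AddCommGroup C] [Module S C] (f : A →ₗ[S] B)
    (g : B →ₗ[S] C) (hfg : g ∘ₗ f = 0) :
    (LinearMap.ker (LinearMap.lcomp S E f) ⧸
      (LinearMap.range (LinearMap.lcomp S E g)).submoduleOf (LinearMap.ker (LinearMap.lcomp S E f)))
      ≃ₗ[S] ((LinearMap.ker g ⧸ (LinearMap.range f).submoduleOf (LinearMap.ker g)) →ₗ[S] E) :=
  let Φ : LinearMap.ker (LinearMap.lcomp S E f) →ₗ[S]
      ((LinearMap.ker g ⧸ (LinearMap.range f).submoduleOf (LinearMap.ker g)) →ₗ[S] E) :=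
    { toFun := fun φ => Submodule.liftQ _ (φ.1 ∘ₗ (LinearMap.ker g).subtype) (by
        rintro ⟨_, hb⟩ ⟨a, rfl⟩
        exact LinearMap.congr_fun (LinearMap.mem_ker.mp φ.2) a)
      map_add' := fun φ ψ => by ext; rfl
      map_smul' := fun s φ => by ext; rfl }
  have hΦ : ∀ (φ : LinearMap.ker (LinearMap.lcomp S E f)) (b : LinearMap.ker g),
      Φ φ (Submodule.Quotient.mk b) = φ.1 b := fun φ b => rfl
  have hker : LinearMap.ker Φ = (LinearMap.range (LinearMap.lcomp S E g)).submoduleOf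
      (LinearMap.ker (LinearMap.lcomp S E f)) := by
    ext φ
    rw [LinearMap.mem_ker]
    constructor
    · intro h
      have h0 : LinearMap.ker g ≤ LinearMap.ker φ.1 := fun b hb => by
        rw [LinearMap.mem_ker, ← hΦ φ ⟨b, hb⟩, h, LinearMap.zero_apply]
      -- A form vanishing on `ker g` factors through `B / ker g`, which `g` embeds in `C`;
      -- injectivity of `E` extends it to `C`.
      obtain ⟨ψ, hψ⟩ := hE.out ((LinearMap.ker g).liftQ g le_rfl)
        (by rw [← LinearMap.ker_eq_bot]; exact Submodule.ker_liftQ_eq_bot _ _ _ le_rfl)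
        ((LinearMap.ker g).liftQ φ.1 h0)
      exact ⟨ψ, LinearMap.ext fun b => hψ (Submodule.Quotient.mk b)⟩
    · rintro ⟨ψ, hψ⟩
      refine LinearMap.ext fun q => ?_
      obtain ⟨b, rfl⟩ := Submodule.Quotient.mk_surjective _ q
      rw [hΦ, ← Submodule.subtype_apply, ← hψ]
      change ψ (g b) = 0
      rw [LinearMap.mem_ker.mp b.2, map_zero]
  have hsurj : Function.Surjective Φ := fun ψ => by
    obtain ⟨φ, hφ⟩ := hE.out (LinearMap.ker g).subtype Subtype.val_injective
      (ψ ∘ₗ Submodule.mkQ _)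
    refine ⟨⟨φ, LinearMap.ext fun a => ?_⟩, LinearMap.ext fun q => ?_⟩
    · have hfa : f a ∈ LinearMap.ker g := LinearMap.congr_fun hfg a
      have h1 := hφ ⟨f a, hfa⟩
      have h2 : Submodule.Quotient.mk (p := (LinearMap.range f).submoduleOf (LinearMap.ker g))
          ⟨f a, hfa⟩ = 0 := (Submodule.Quotient.mk_eq_zero _).mpr ⟨a, rfl⟩
      refine h1.trans ?_
      change ψ (Submodule.Quotient.mk _) = 0
      rw [h2, map_zero]
    · obtain ⟨b, rfl⟩ := Submodule.Quotient.mk_surjective _ q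
      exact hφ b
  (Submodule.quotEquivOfEq _ _ hker.symm).trans (Φ.quotKerEquivOfSurjective hsurj)

/-- Equal pairs of submodules have isomorphic subquotients. -/
def subquotientEquivOfEq {B : Type u} [AddCommGroup B] [Module S B] {p p' q q' : Submodule S B}
    (hp : p = p') (hq : q = q') : (p ⧸ q.submoduleOf p) ≃ₗ[S] (p' ⧸ q'.submoduleOf p') := by
  subst hp hq
  exact LinearEquiv.refl _ _

lemma ker_units_smul {A B : Type u} [AddCommGroup A] [Module S A] [AddCommGroup B] [Module S B]
    (c : ℤˣ) (f : A →ₗ[S] B) : LinearMap.ker (c • f) = LinearMap.ker f := by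
  ext x
  exact smul_eq_zero_iff_eq (β := B) c

lemma range_units_smul {A B : Type u} [AddCommGroup A] [Module S A] [AddCommGroup B] [Module S B]
    (c : ℤˣ) (f : A →ₗ[S] B) : LinearMap.range (c • f) = LinearMap.range f := by
  obtain rfl | rfl := Int.units_eq_one_or c
  · rw [one_smul]
  · rw [Units.neg_smul, one_smul, LinearMap.range_neg]

/-- For an injective module `E`, one has `H^n(Hom(K, E)) ≃ Hom(H^{-n}(K), E)`. -/
noncomputable def homologyHomToModuleEquiv (hE : Module.Injective S E)
    (K : CochainComplex (ModuleCat.{u} S) ℤ) (n : ℤ) :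
    (homToModule K E).homology n ≃ₗ[S] (K.homology (-n) →ₗ[S] E) :=
  -- The signs in the differential of the dual complex affect neither kernels nor images.
  have hk : ∀ i j : ℤ, LinearMap.ker ((homToModule K E).d i j).hom =
      LinearMap.ker (LinearMap.lcomp S E (K.d (-j) (-i)).hom) := fun i j =>
    ker_units_smul j.negOnePow _
  have hr : ∀ i j : ℤ, LinearMap.range ((homToModule K E).d i j).hom =
      LinearMap.range (LinearMap.lcomp S E (K.d (-j) (-i)).hom) := fun i j =>
    range_units_smul j.negOnePow _
  (homologyEquiv (homToModule K E) (i := n - 1) (j := n) (k := n + 1) (by omega) rfl).trans <|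
  (subquotientEquivOfEq (hk n (n + 1)) (hr (n - 1) n)).trans <|
  (homologyDualEquiv hE (K.d (-(n + 1)) (-n)).hom (K.d (-n) (-(n - 1))).hom (by
    rw [← ModuleCat.hom_comp, K.d_comp_d]; rfl)).trans <|
  LinearEquiv.arrowCongr (homologyEquiv K (by omega) (by omega)).symm (LinearEquiv.refl S E)

end HomologyOfModules

/-! ### Biduality for complexes whose homology consists of finite-dimensional `l`-spaces -/

section Biduality

variable {S : Type u} [CommRing S] (E : Type u) [AddCommGroup E] [Module S E]

/-- Evaluation, as a linear map to the double dual, up to the identification of `-(-n)` with `n`. -/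
noncomputable def evalDual (Z : CochainComplex (ModuleCat.{u} S) ℤ) (n : ℤ) :
    Z.X n →ₗ[S] ((Z.X (-(-n)) →ₗ[S] E) →ₗ[S] E) :=
  LinearMap.flip (LinearMap.lcomp S E (Z.XIsoOfEq (neg_neg n).symm).hom.hom)

lemma evalDual_apply (Z : CochainComplex (ModuleCat.{u} S) ℤ) (n : ℤ) (z : Z.X n)
    (f : Z.X (-(-n)) →ₗ[S] E) :
    evalDual E Z n z f = f ((Z.XIsoOfEq (neg_neg n).symm).hom z) := rfl

lemma XIsoOfEq_d_apply (Z : CochainComplex (ModuleCat.{u} S) ℤ) {i i' j j' : ℤ} (hi : i = i')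
    (hj : j = j') (z : Z.X i) :
    Z.d i' j' ((Z.XIsoOfEq hi).hom z) = (Z.XIsoOfEq hj).hom (Z.d i j z) := by
  subst hi hj
  rfl

/-- The biduality morphism `Z ⟶ Hom(Hom(Z, E), E)`. -/
noncomputable def biduality (Z : CochainComplex (ModuleCat.{u} S) ℤ) :
    Z ⟶ homToModule (homToModule Z E) E where
  -- The signs of the two dualizations multiply to `-1`, so plain evaluation anticommutes with the
  -- differentials; the factor `(-1)^n` repairs this.
  f n := ModuleCat.ofHom (n.negOnePow • evalDual E Z n)
  comm' n m hnm := by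
    obtain rfl : n + 1 = m := hnm
    refine ModuleCat.hom_ext (LinearMap.ext fun z =>
      LinearMap.ext fun (f : Z.X (-(-(n + 1))) →ₗ[S] E) => ?_)
    change (n + 1).negOnePow • n.negOnePow • evalDual E Z n z
        ((-n).negOnePow • f ∘ₗ (Z.d (-(-n)) (-(-(n + 1)))).hom) =
      (n + 1).negOnePow • evalDual E Z (n + 1) (Z.d n (n + 1) z) f
    rw [evalDual_apply, evalDual_apply, ← XIsoOfEq_d_apply Z (neg_neg n).symm]
    rw [Int.negOnePow_neg]
    change (n + 1).negOnePow • n.negOnePow • n.negOnePow • f (Z.d (-(-n)) (-(-(n + 1))) _) = _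
    rw [← mul_smul n.negOnePow, Int.units_mul_self, one_smul]

/-- A cycle `z` that is not a boundary is detected by a form `f` vanishing on boundaries, hence a
cocycle of the dual. If evaluation at `z` were the boundary of `w`, then `f(z)` would be, up to
sign, the value of `w` at `f ∘ d = 0`. No finiteness is needed. -/
lemma biduality_homologyMap_injective [IsLocalRing S] {E : Type u} [AddCommGroup E] [Module S E]
    {ι : IsLocalRing.ResidueField S →ₗ[S] E} (hE : IsInjectiveHull ι)
    (Z : CochainComplex (ModuleCat.{u} S) ℤ) (n : ℤ) :
    Function.Injective (HomologicalComplex.homologyMap (biduality E Z) n) := by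
  refine homologyMap_injective _ (i := n - 1) (n + 1) (by omega) fun z hz w hw => ?_
  by_contra hne
  have hne' : (LinearMap.range (Z.d (n - 1) n).hom).mkQ z ≠ 0 := by
    rw [Submodule.mkQ_apply, Ne, Submodule.Quotient.mk_eq_zero]
    exact hne
  obtain ⟨f, hf⟩ := exists_dual_apply_ne_zero hE hne'
  let g : Z.X (-(-n)) →ₗ[S] E :=
    f ∘ₗ (LinearMap.range (Z.d (n - 1) n).hom).mkQ ∘ₗ (Z.XIsoOfEq (neg_neg n)).hom.hom
  have hg : g ∘ₗ (Z.d (-(-(n - 1))) (-(-n))).hom = 0 := by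
    refine LinearMap.ext fun v => ?_
    have h1 := XIsoOfEq_d_apply Z (neg_neg (n - 1)) (neg_neg n) v
    change f (Submodule.Quotient.mk ((Z.XIsoOfEq (neg_neg n)).hom _)) = 0
    erw [← h1]
    have h2 : Submodule.Quotient.mk (p := LinearMap.range (Z.d (n - 1) n).hom)
        (Z.d (n - 1) n ((Z.XIsoOfEq (neg_neg (n - 1))).hom v)) = 0 :=
      (Submodule.Quotient.mk_eq_zero _).mpr ⟨_, rfl⟩
    rw [h2, map_zero]
  have hw' : n.negOnePow • (show (Z.X (-(-(n - 1))) →ₗ[S] E) →ₗ[S] E from w) ∘ₗ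
      ((-(n - 1)).negOnePow • LinearMap.lcomp S E (Z.d (-(-(n - 1))) (-(-n))).hom) =
      n.negOnePow • evalDual E Z n z := hw
  have h2 := LinearMap.congr_fun (smul_left_cancel _ hw') g
  rw [LinearMap.comp_apply, LinearMap.smul_apply, LinearMap.lcomp_apply', hg, smul_zero, map_zero,
    evalDual_apply] at h2
  have h3 : g ((Z.XIsoOfEq (neg_neg n).symm).hom z) = f ((LinearMap.range (Z.d (n - 1) n).hom).mkQ z) := by
    change f (Submodule.Quotient.mk ((Z.XIsoOfEq (neg_neg n)).hom _)) = _
    rw [← ConcreteCategory.comp_apply]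
    simp
  exact hf (h3.symm.trans h2.symm)

/-- Dualization commutes with homology and preserves the length of finite-dimensional `l`-spaces, so
the injective map on homology is between modules of the same finite length. -/
lemma biduality_quasiIso [IsLocalRing S] [IsNoetherianRing S] {E : Type u} [AddCommGroup E]
    [Module S E] {ι : IsLocalRing.ResidueField S →ₗ[S] E} (hE : IsInjectiveHull ι)
    (Z : CochainComplex (ModuleCat.{u} S) ℤ)
    (hZ : ∀ n, IsFiniteResidueSpace (S := S) (Z.homology n)) :
    QuasiIso (biduality E Z) := by
  rw [quasiIso_iff]
  intro n
  rw [quasiIsoAt_iff_isIso_homologyMap]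
  have e1 := homologyHomToModuleEquiv hE.injective_module (homToModule Z E) n
  have e2 := homologyHomToModuleEquiv hE.injective_module Z (-n)
  obtain ⟨h1, h1'⟩ := finite_dual hE (hZ (-(-n)))
  have h2' : IsFiniteResidueSpace (S := S) ((homToModule Z E).homology (-n)) :=
    ⟨have := h1'.1; Module.Finite.equiv e2.symm, e2.annihilator_eq ▸ h1'.2⟩
  obtain ⟨h3, -⟩ := finite_dual hE h2'
  have h4 : Module.length S (Z.homology n) =
      Module.length S ((homToModule (homToModule Z E) E).homology n) := by
    rw [e1.length_eq, h3, e2.length_eq, h1, neg_neg]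
  have h5 := bijective_of_injective_of_length_eq _
    (biduality_homologyMap_injective hE Z n) h4 (length_ne_top_of_isFiniteResidueSpace (hZ n))
  rw [ConcreteCategory.isIso_iff_bijective]
  exact h5

end Biduality

/-! ### Null-homotopic homotheties, and permuting the elements of a Koszul complex -/

section Koszul

open CochainComplex CochainComplex.HomComplex

variable {S : Type u} [CommRing S]

lemma ofHom_smul {F G : CochainComplex (ModuleCat.{u} S) ℤ} (s : S) (f : F ⟶ G) :
    Cochain.ofHom (s • f) = s • Cochain.ofHom f := by
  ext p
  simp

/-- The ideal of all `s` such that the homothety `s` of the complex `Z` is null-homotopic. -/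
def homotopyAnnihilator (Z : CochainComplex (ModuleCat.{u} S) ℤ) : Ideal S where
  carrier := {s | ∃ h : Cochain Z Z (-1), δ (-1) 0 h = Cochain.ofHom (s • 𝟙 Z)}
  zero_mem' := ⟨0, by simp⟩
  add_mem' := by
    rintro s t ⟨h, hh⟩ ⟨k, hk⟩
    exact ⟨h + k, by rw [δ_add, hh, hk, add_smul, Cochain.ofHom_add]⟩
  smul_mem' := by
    rintro c s ⟨h, hh⟩
    exact ⟨c • h, by rw [δ_smul, hh, smul_eq_mul, mul_smul, ofHom_smul c]⟩

/-- The null-homotopy projects the cone onto `Z` and reinserts the result as the shifted copy of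
`Z`. -/
lemma mem_homotopyAnnihilator_mappingCone (Z : CochainComplex (ModuleCat.{u} S) ℤ) (s : S) :
    s ∈ homotopyAnnihilator (mappingCone (s • 𝟙 Z)) := by
  refine ⟨(mappingCone.snd _).comp (mappingCone.inl _) (zero_add (-1)), ?_⟩
  rw [δ_zero_cochain_comp _ _ _ (by omega), mappingCone.δ_inl, mappingCone.δ_snd,
    ofHom_smul s (𝟙 (mappingCone _)), ← mappingCone.id, Cochain.ofHom_comp, ofHom_smul]
  simp
  exact add_comm _ _

lemma homotopyAnnihilator_le_mappingCone (Z : CochainComplex (ModuleCat.{u} S) ℤ) (s : S) :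
    homotopyAnnihilator Z ≤ homotopyAnnihilator (mappingCone (s • 𝟙 Z)) := by
  rintro t ⟨h, hh⟩
  -- A null-homotopy `h` on `Z` acts diagonally on the cone, as `-h` on the shifted summand and `h`
  -- on the other; since `h` is `S`-linear, the off-diagonal terms cancel.
  refine ⟨mappingCone.descCochain _ (-(h.comp (mappingCone.inl _) (show -1 + -1 = -2 by rfl)))
    (h.comp (Cochain.ofHom (mappingCone.inr _)) (add_zero (-1))) (by omega), ?_⟩
  rw [mappingCone.δ_descCochain _ _ _ _ 0 (by omega)]
  rw [δ_neg, δ_comp _ _ _ 0 0 (-1) (by omega) (by omega) (by omega), δ_comp_ofHom, hh,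
    mappingCone.δ_inl, ofHom_smul t (𝟙 (mappingCone _)), ← mappingCone.id, Cochain.ofHom_comp,
    ofHom_smul, ofHom_smul]
  simp

lemma homotopyAnnihilator_le_koszulList (Z : CochainComplex (ModuleCat.{u} S) ℤ) (l : List S) :
    homotopyAnnihilator Z ≤ homotopyAnnihilator (koszulList Z l) := by
  induction l with
  | nil => exact le_rfl
  | cons x l ih => exact ih.trans (homotopyAnnihilator_le_mappingCone _ x)

lemma mem_homotopyAnnihilator_koszulList (Z : CochainComplex (ModuleCat.{u} S) ℤ) {l : List S}
    {s : S} (hs : s ∈ l) : s ∈ homotopyAnnihilator (koszulList Z l) := by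
  induction l with
  | nil => simp at hs
  | cons x l ih =>
    rcases List.mem_cons.mp hs with rfl | hs
    · exact mem_homotopyAnnihilator_mappingCone _ _
    · exact homotopyAnnihilator_le_mappingCone _ x (ih hs)

lemma span_le_homotopyAnnihilator_koszul (Z : CochainComplex (ModuleCat.{u} S) ℤ) {e : ℕ}
    (x : Fin e → S) : Ideal.span (Set.range x) ≤ homotopyAnnihilator (koszul x Z) := by
  rw [Ideal.span_le]
  rintro _ ⟨i, rfl⟩
  exact mem_homotopyAnnihilator_koszulList Z (List.mem_ofFn.mpr ⟨i, rfl⟩)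

lemma koszulList_append (Z : CochainComplex (ModuleCat.{u} S) ℤ) (l l' : List S) :
    koszulList Z (l ++ l') = koszulList (koszulList Z l') l := by
  induction l with
  | nil => rfl
  | cons x l ih =>
    change mappingCone (x • 𝟙 (koszulList Z (l ++ l'))) = _
    rw [ih]
    rfl

/-- An isomorphism of complexes induces an isomorphism of cones of homotheties. -/
noncomputable def mappingConeSMulIso {Z Z' : CochainComplex (ModuleCat.{u} S) ℤ} (e : Z ≅ Z')
    (x : S) : mappingCone (x • 𝟙 Z) ≅ mappingCone (x • 𝟙 Z') where
  hom := mappingCone.map _ _ e.hom e.hom (by simp)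
  inv := mappingCone.map _ _ e.inv e.inv (by simp)
  hom_inv_id := by
    rw [← mappingCone.map_comp]
    simp only [Iso.hom_inv_id]
    exact mappingCone.map_id _
  inv_hom_id := by
    rw [← mappingCone.map_comp]
    simp only [Iso.inv_hom_id]
    exact mappingCone.map_id _

/-- The comparison morphism between the two iterated cones of a pair of homotheties. -/
noncomputable def mappingConeSwap (Z : CochainComplex (ModuleCat.{u} S) ℤ) (x y : S) :
    mappingCone (x • 𝟙 (mappingCone (y • 𝟙 Z))) ⟶ mappingCone (y • 𝟙 (mappingCone (x • 𝟙 Z))) :=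
  mappingCone.desc _
    (mappingCone.descCochain _
      -- Exchanging the two degree-one Koszul generators costs this sign; the other three summands
      -- are matched without sign.
      (-((mappingCone.inl (x • 𝟙 Z)).comp (mappingCone.inl (y • 𝟙 (mappingCone (x • 𝟙 Z))))
        (show -1 + -1 = -2 by rfl)))
      ((mappingCone.inl (x • 𝟙 Z)).comp
        (Cochain.ofHom (mappingCone.inr (y • 𝟙 (mappingCone (x • 𝟙 Z))))) (add_zero (-1)))
      (by omega))
    (mappingCone.map _ _ (mappingCone.inr _) (mappingCone.inr _) (by simp))
    (by
      rw [mappingCone.δ_descCochain _ _ _ _ 0 (by omega)]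
      rw [δ_neg, δ_comp _ _ _ 0 0 (-1) (by omega) (by omega) (by omega), δ_comp_ofHom,
        mappingCone.ext_cochain_from_iff _ (-1) 0 (by omega)]
      simp only [mappingCone.δ_inl, Cochain.ofHom_comp, ofHom_smul, mappingCone.map,
        mappingCone.ofHom_desc]
      constructor
      · simp
      · simp)

lemma mappingConeSwap_comp (Z : CochainComplex (ModuleCat.{u} S) ℤ) (x y : S) :
    mappingConeSwap Z x y ≫ mappingConeSwap Z y x = 𝟙 _ := by
  ext1 p
  have h := fun (x y : S) => Cochain.comp_v (mappingCone.inl (x • 𝟙 Z))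
    (mappingCone.inl (y • 𝟙 (mappingCone (x • 𝟙 Z)))) (show -1 + -1 = -2 by rfl) (p + 2) (p + 1) p
    (by omega) (by omega)
  rw [mappingCone.ext_from_iff _ (p + 1) p rfl, mappingCone.ext_from_iff _ (p + 2) (p + 1) (by omega),
    mappingCone.ext_from_iff _ (p + 1) p rfl]
  refine ⟨⟨?_, ?_⟩, ⟨?_, ?_⟩⟩
  · simp [mappingConeSwap, h]
  · simp [mappingConeSwap, mappingCone.map]
  · simp [mappingConeSwap, mappingCone.map]
  · simp [mappingConeSwap, mappingCone.map]

/-- Cones of homotheties commute. -/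
noncomputable def mappingConeSwapIso (Z : CochainComplex (ModuleCat.{u} S) ℤ) (x y : S) :
    mappingCone (x • 𝟙 (mappingCone (y • 𝟙 Z))) ≅ mappingCone (y • 𝟙 (mappingCone (x • 𝟙 Z))) where
  hom := mappingConeSwap Z x y
  inv := mappingConeSwap Z y x
  hom_inv_id := mappingConeSwap_comp Z x y
  inv_hom_id := mappingConeSwap_comp Z y x

lemma nonempty_koszulList_iso_of_perm (Z : CochainComplex (ModuleCat.{u} S) ℤ) {l l' : List S}
    (h : l.Perm l') : Nonempty (koszulList Z l ≅ koszulList Z l') := by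
  induction h with
  | nil => exact ⟨Iso.refl _⟩
  | cons x _ ih => exact ih.map fun e => mappingConeSMulIso e x
  | swap x y l => exact ⟨mappingConeSwapIso _ y x⟩
  | trans _ _ ih ih' => exact ⟨ih.some ≪≫ ih'.some⟩

/-- The Koszul complexes on two families can be formed in either order. -/
lemma nonempty_koszul_koszul_iso (Z : CochainComplex (ModuleCat.{u} S) ℤ) {d e : ℕ}
    (x : Fin d → S) (y : Fin e → S) :
    Nonempty (koszul x (koszul y Z) ≅ koszul y (koszul x Z)) := by
  rw [koszul, koszul, koszul, koszul, ← koszulList_append, ← koszulList_append]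
  exact nonempty_koszulList_iso_of_perm Z List.perm_append_comm

end Koszul

/-! ### Finite generation and vanishing of Koszul homology -/

section KoszulHomology

open CochainComplex

variable {S : Type u} [CommRing S]

lemma exists_exact_of_iso {T : ShortComplex (ModuleCat.{u} S)} (hT : T.Exact)
    {A B C : ModuleCat.{u} S} (e₁ : T.X₁ ≅ A) (e₂ : T.X₂ ≅ B) (e₃ : T.X₃ ≅ C) :
    ∃ (a : A →ₗ[S] B) (b : B →ₗ[S] C), Function.Exact a b := by
  refine ⟨(e₁.inv ≫ T.f ≫ e₂.hom).hom, (e₂.inv ≫ T.g ≫ e₃.hom).hom, fun v => ⟨fun hv => ?_, ?_⟩⟩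
  · have h1 : T.g (e₂.inv v) = 0 := by
      have h2 := congrArg e₃.inv hv
      rw [map_zero] at h2
      simpa using h2
    obtain ⟨w, hw⟩ := T.moduleCat_exact_iff.mp hT _ h1
    refine ⟨e₁.hom w, ?_⟩
    change (e₁.inv ≫ T.f ≫ e₂.hom) (e₁.hom w) = v
    simp [hw]
  · rintro ⟨w, rfl⟩
    change (e₂.inv ≫ T.g ≫ e₃.hom) ((e₁.inv ≫ T.f ≫ e₂.hom) w) = 0
    simp

/-- A piece of the long exact sequence of a cone. For finiteness and vanishing only exactness at the
cone matters, so the maps are left unspecified. -/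
lemma exists_mappingCone_homology_exact {Z W : CochainComplex (ModuleCat.{u} S) ℤ} (f : Z ⟶ W)
    (n : ℤ) : ∃ (a : W.homology n →ₗ[S] (mappingCone f).homology n)
      (b : (mappingCone f).homology n →ₗ[S] Z.homology (n + 1)), Function.Exact a b := by
  have h := (HomotopyCategory.homologyFunctor (ModuleCat.{u} S) (ComplexShape.up ℤ) 0).homologySequence_exact₃
    (mappingCone.triangleh f) (HomotopyCategory.mappingCone_triangleh_distinguished f) n (n + 1) rfl
  exact exists_exact_of_iso h
    ((HomotopyCategory.homologyFunctorFactors (ModuleCat.{u} S) (ComplexShape.up ℤ) n).app W)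
    ((HomotopyCategory.homologyFunctorFactors (ModuleCat.{u} S) (ComplexShape.up ℤ) n).app _)
    ((HomotopyCategory.homologyFunctorFactors (ModuleCat.{u} S) (ComplexShape.up ℤ) (n + 1)).app Z)

lemma finite_homology_koszulList [IsNoetherianRing S] {Z : CochainComplex (ModuleCat.{u} S) ℤ}
    (hZ : ∀ n, Module.Finite S (Z.homology n)) (l : List S) (n : ℤ) :
    Module.Finite S ((koszulList Z l).homology n) := by
  induction l generalizing n with
  | nil => exact hZ n
  | cons x l ih =>
    obtain ⟨a, b, hab⟩ := exists_mappingCone_homology_exact (x • 𝟙 (koszulList Z l)) n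
    have h1 := ih n
    have h2 := ih (n + 1)
    have := isNoetherian_of_range_eq_ker a b (LinearMap.exact_iff.mp hab).symm
    exact inferInstanceAs (Module.Finite S ((mappingCone (x • 𝟙 (koszulList Z l))).homology n))

lemma subsingleton_homology_koszulList {Z : CochainComplex (ModuleCat.{u} S) ℤ} {b : ℤ}
    (hZ : ∀ n < b, Subsingleton (Z.homology n)) (l : List S) :
    ∃ c : ℤ, ∀ n < c, Subsingleton ((koszulList Z l).homology n) := by
  induction l with
  | nil => exact ⟨b, hZ⟩
  | cons x l ih =>
    obtain ⟨c, hc⟩ := ih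
    -- The homology of the cone in degree `n` also involves degree `n + 1`, so each element lowers
    -- the bound by one.
    refine ⟨c - 1, fun n hn => ?_⟩
    obtain ⟨f, g, hfg⟩ := exists_mappingCone_homology_exact (x • 𝟙 (koszulList Z l)) n
    have h1 := hc n (by omega)
    have h2 := hc (n + 1) (by omega)
    refine subsingleton_of_forall_eq (α := (mappingCone (x • 𝟙 (koszulList Z l))).homology n) 0
      fun v => ?_
    obtain ⟨w, rfl⟩ := (hfg v).mp (Subsingleton.elim _ _)
    rw [Subsingleton.elim w 0, map_zero]

end KoszulHomology

/-! ### Dualizing cochains, and the dual of the cone of a homothety -/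

section Dual

open CochainComplex CochainComplex.HomComplex

variable {S : Type u} [CommRing S] (E : Type u) [AddCommGroup E] [Module S E]

/-- The action of the contravariant functor `Hom(-, E)` on cochains. -/
noncomputable def dualCochain {A B : CochainComplex (ModuleCat.{u} S) ℤ} {p : ℤ}
    (γ : Cochain A B p) : Cochain (homToModule B E) (homToModule A E) p :=
  -- With the sign `(-1)^(p n)` dualization commutes with `δ` exactly, and reverses composition up
  -- to `(-1)^(p q)`.
  Cochain.mk fun n m h => ModuleCat.ofHom
    ((p * n).negOnePow • LinearMap.lcomp S E (γ.v (-m) (-n) (by omega)).hom)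

lemma δ_dualCochain {A B : CochainComplex (ModuleCat.{u} S) ℤ} {p q : ℤ} (hpq : p + 1 = q)
    (γ : Cochain A B p) : δ p q (dualCochain E γ) = dualCochain E (δ p q γ) := by
  refine Cochain.ext _ _ fun n m hnm => ModuleCat.hom_ext (LinearMap.ext
    fun (f : B.X (-n) →ₗ[S] E) => LinearMap.ext fun (a : A.X (-m)) => ?_)
  rw [δ_v p q hpq _ n m hnm (m - 1) (n + 1) rfl rfl]
  change m.negOnePow • ((p * n).negOnePow •
      f (γ.v (-(m - 1)) (-n) (by omega) (A.d (-m) (-(m - 1)) a))) +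
    q.negOnePow • ((p * (n + 1)).negOnePow • (n + 1).negOnePow •
      f (B.d (-(n + 1)) (-n) (γ.v (-m) (-(n + 1)) (by omega) a))) =
    (q * n).negOnePow • f ((δ p q γ).v (-m) (-n) (by omega) a)
  rw [δ_v p q hpq γ (-m) (-n) (by omega) (-(n + 1)) (-(m - 1)) (by omega) (by omega)]
  change _ = (q * n).negOnePow • f (B.d (-(n + 1)) (-n) (γ.v (-m) (-(n + 1)) (by omega) a) +
    q.negOnePow • γ.v (-(m - 1)) (-n) (by omega) (A.d (-m) (-(m - 1)) a))
  have h0 : ∀ b, f (q.negOnePow • b) = q.negOnePow • f b := fun b => by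
    rw [Units.smul_def, Units.smul_def, map_zsmul]
  rw [map_add, h0, smul_add, add_comm]
  simp only [smul_smul, ← Int.negOnePow_add]
  congr 2
  · rw [Int.negOnePow_eq_iff]
    exact ⟨p + 1, by subst hpq; ring⟩
  · congr 1
    subst hpq hnm
    ring

lemma dualCochain_comp {A B C : CochainComplex (ModuleCat.{u} S) ℤ} {p q r : ℤ} (γ : Cochain A B p)
    (γ' : Cochain B C q) (h : p + q = r) :
    dualCochain E (γ.comp γ' h) =
      (p * q).negOnePow • (dualCochain E γ').comp (dualCochain E γ) (by omega) := by
  refine Cochain.ext _ _ fun n m hnm => ModuleCat.hom_ext (LinearMap.ext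
    fun (f : C.X (-n) →ₗ[S] E) => LinearMap.ext fun (a : A.X (-m)) => ?_)
  rw [Cochain.units_smul_v, Cochain.comp_v _ _ _ n (n + q) m rfl (by omega)]
  change (r * n).negOnePow • f ((γ.comp γ' h).v (-m) (-n) (by omega) a) =
    (p * q).negOnePow • (p * (n + q)).negOnePow • (q * n).negOnePow •
      f (γ'.v (-(n + q)) (-n) (by omega) (γ.v (-m) (-(n + q)) (by omega) a))
  rw [Cochain.comp_v γ γ' h (-m) (-(n + q)) (-n) (by omega) (by omega)]
  simp only [smul_smul, ← Int.negOnePow_add]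
  congr 1
  rw [Int.negOnePow_eq_iff]
  exact ⟨- p * q, by subst h; ring⟩

lemma dualCochain_add {A B : CochainComplex (ModuleCat.{u} S) ℤ} {p : ℤ} (γ γ' : Cochain A B p) :
    dualCochain E (γ + γ') = dualCochain E γ + dualCochain E γ' := by
  refine Cochain.ext _ _ fun n m hnm => ModuleCat.hom_ext (LinearMap.ext
    fun (f : B.X (-n) →ₗ[S] E) => LinearMap.ext fun (a : A.X (-m)) => ?_)
  change (p * n).negOnePow • f (γ.v (-m) (-n) _ a + γ'.v (-m) (-n) _ a) =
    (p * n).negOnePow • f (γ.v (-m) (-n) _ a) + (p * n).negOnePow • f (γ'.v (-m) (-n) _ a)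
  rw [map_add, smul_add]

lemma dualCochain_smul {A B : CochainComplex (ModuleCat.{u} S) ℤ} {p : ℤ} (s : S)
    (γ : Cochain A B p) : dualCochain E (s • γ) = s • dualCochain E γ := by
  refine Cochain.ext _ _ fun n m hnm => ModuleCat.hom_ext (LinearMap.ext
    fun (f : B.X (-n) →ₗ[S] E) => LinearMap.ext fun (a : A.X (-m)) => ?_)
  change (p * n).negOnePow • f (s • γ.v (-m) (-n) _ a) =
    s • (p * n).negOnePow • f (γ.v (-m) (-n) _ a)
  rw [map_smul, smul_comm]

lemma dualCochain_id (A : CochainComplex (ModuleCat.{u} S) ℤ) :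
    dualCochain E (Cochain.ofHom (𝟙 A)) = Cochain.ofHom (𝟙 (homToModule A E)) := by
  refine Cochain.ext₀ _ _ fun n => ModuleCat.hom_ext (LinearMap.ext
    fun (f : A.X (-n) →ₗ[S] E) => LinearMap.ext fun (a : A.X (-n)) => ?_)
  change (0 * n).negOnePow • f a = f a
  rw [zero_mul, Int.negOnePow_zero, one_smul]

/-- The morphism of complexes induced by `Hom(-, E)`. -/
noncomputable def homToModuleMap {A B : CochainComplex (ModuleCat.{u} S) ℤ} (f : A ⟶ B) :
    homToModule B E ⟶ homToModule A E :=
  Cocycle.homOf (Cocycle.mk (dualCochain E (Cochain.ofHom f)) 1 (by omega) (by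
    rw [δ_dualCochain E (by omega), δ_ofHom, ← zero_smul S (0 : Cochain A B 1), dualCochain_smul,
      zero_smul]))

lemma ofHom_homToModuleMap {A B : CochainComplex (ModuleCat.{u} S) ℤ} (f : A ⟶ B) :
    Cochain.ofHom (homToModuleMap E f) = dualCochain E (Cochain.ofHom f) := by
  simp [homToModuleMap]

lemma homotopyAnnihilator_le_homToModule (A : CochainComplex (ModuleCat.{u} S) ℤ) :
    homotopyAnnihilator A ≤ homotopyAnnihilator (homToModule A E) := by
  rintro s ⟨h, hh⟩
  refine ⟨dualCochain E h, ?_⟩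
  rw [δ_dualCochain E (by omega), hh, ofHom_smul, ofHom_smul, dualCochain_smul, dualCochain_id]

lemma dualCochain_zero {A B : CochainComplex (ModuleCat.{u} S) ℤ} {p : ℤ} :
    dualCochain E (0 : Cochain A B p) = 0 := by
  rw [← zero_smul S (0 : Cochain A B p), dualCochain_smul, zero_smul]

lemma dualCochain_neg {A B : CochainComplex (ModuleCat.{u} S) ℤ} {p : ℤ} (γ : Cochain A B p) :
    dualCochain E (-γ) = -dualCochain E γ := by
  rw [← neg_one_smul S γ, dualCochain_smul, neg_one_smul]

/-- Obtained by dualizing the relations that make a cone a biproduct in each degree. A minus sign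
appears whenever the odd cochains `inl` and `fst` are composed with each other. -/
lemma dualCochain_mappingCone_relations {A B : CochainComplex (ModuleCat.{u} S) ℤ} (φ : A ⟶ B)
    (p q : ℤ) (hpq : p + -1 = q) :
    (dualCochain E (mappingCone.snd φ)).v p p (add_zero p) ≫
        (dualCochain E (Cochain.ofHom (mappingCone.inr φ))).v p p (add_zero p) = 𝟙 _ ∧
    (dualCochain E (mappingCone.snd φ)).v p p (add_zero p) ≫
        (dualCochain E (mappingCone.inl φ)).v p q hpq = 0 ∧
    (dualCochain E (mappingCone.fst φ).1).v q p (by omega) ≫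
        (dualCochain E (Cochain.ofHom (mappingCone.inr φ))).v p p (add_zero p) = 0 ∧
    (dualCochain E (mappingCone.fst φ).1).v q p (by omega) ≫
        (dualCochain E (mappingCone.inl φ)).v p q hpq = -𝟙 _ ∧
    (dualCochain E (Cochain.ofHom (mappingCone.inr φ))).v p p (add_zero p) ≫
        (dualCochain E (mappingCone.snd φ)).v p p (add_zero p) -
      (dualCochain E (mappingCone.inl φ)).v p q hpq ≫
        (dualCochain E (mappingCone.fst φ).1).v q p (by omega) = 𝟙 _ := by
  refine ⟨?_, ?_, ?_, ?_, ?_⟩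
  · have h := congrArg (dualCochain E) (mappingCone.inr_snd φ)
    rw [dualCochain_comp, dualCochain_id] at h
    simpa using Cochain.congr_v h p p (add_zero p)
  · have h := congrArg (dualCochain E) (mappingCone.inl_snd φ)
    rw [dualCochain_comp, dualCochain_zero] at h
    simpa using Cochain.congr_v h p q hpq
  · have h := congrArg (dualCochain E) (mappingCone.inr_fst φ)
    rw [dualCochain_comp, dualCochain_zero] at h
    have h' := Cochain.congr_v h q p (by omega)
    rw [Cochain.units_smul_v, Cochain.comp_v _ _ _ q p p (by omega) (add_zero p)] at h'
    simpa using h'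
  · have h := congrArg (dualCochain E) (mappingCone.inl_fst φ)
    rw [dualCochain_comp, dualCochain_id] at h
    have h' := Cochain.congr_v h q q (add_zero q)
    rw [Cochain.units_smul_v, Cochain.comp_v _ _ _ q p q (by omega) hpq] at h'
    rw [eq_neg_iff_add_eq_zero, ← neg_eq_iff_add_eq_zero]
    simpa using h'
  · have h := congrArg (dualCochain E) (mappingCone.id φ)
    rw [dualCochain_add, dualCochain_comp, dualCochain_comp, dualCochain_id] at h
    have h' := Cochain.congr_v h p p (add_zero p)
    rw [Cochain.add_v, Cochain.units_smul_v, Cochain.comp_v _ _ _ p q p hpq (by omega)] at h'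
    rw [sub_eq_neg_add]
    simpa using h'

lemma mappingCocone_lift_f {K L M : CochainComplex (ModuleCat.{u} S) ℤ} (φ : K ⟶ L) (α : M ⟶ K)
    (β : Cochain M L (-1)) (h : δ (-1) 0 β + Cochain.ofHom (α ≫ φ) = 0) (p q : ℤ)
    (hpq : p + -1 = q) :
    (mappingCocone.lift φ α β h).f p = α.f p ≫ (mappingCocone.inl φ).v p p (add_zero p) +
      β.v p q hpq ≫ (mappingCocone.inr φ).1.v q p (by omega) := by
  rw [← Category.comp_id ((mappingCocone.lift φ α β h).f p), ← mappingCocone.id_X φ p q hpq]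
  simp

lemma mappingCocone_desc_f {K L M : CochainComplex (ModuleCat.{u} S) ℤ} (φ : K ⟶ L)
    (α : Cochain K M 0) (β : Cocycle L M 1)
    (h : δ 0 1 α + (Cochain.ofHom φ).comp β.1 (zero_add 1) = 0) (p q : ℤ) (hpq : p + -1 = q) :
    (mappingCocone.desc φ α β h).f p = (mappingCocone.fst φ).f p ≫ α.v p p (add_zero p) +
      (mappingCocone.snd φ).v p q hpq ≫ β.1.v q p (by omega) := by
  rw [← Category.id_comp ((mappingCocone.desc φ α β h).f p), ← mappingCocone.id_X φ p q hpq]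
  simp

/-- The comparison of the dual of the cone of a homothety with a cocone. -/
noncomputable def homToModuleMappingConeHom (A : CochainComplex (ModuleCat.{u} S) ℤ) (s : S) :
    homToModule (mappingCone (s • 𝟙 A)) E ⟶ mappingCocone (s • 𝟙 (homToModule A E)) :=
  mappingCocone.lift _ (homToModuleMap E (mappingCone.inr (s • 𝟙 A)))
    -- The sign is forced by compatibility with the differentials, and it cancels the one in the
    -- composite of the duals of `fst` and `inl`.
    (-dualCochain E (mappingCone.inl (s • 𝟙 A))) (by
      rw [δ_neg, δ_dualCochain E (by omega), mappingCone.δ_inl, Cochain.ofHom_comp, ofHom_smul,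
        Cochain.ofHom_comp, ofHom_smul, ofHom_homToModuleMap]
      simp [dualCochain_smul])

/-- The comparison of a cocone of a homothety with the dual of a cone. -/
noncomputable def homToModuleMappingConeInv (A : CochainComplex (ModuleCat.{u} S) ℤ) (s : S) :
    mappingCocone (s • 𝟙 (homToModule A E)) ⟶ homToModule (mappingCone (s • 𝟙 A)) E :=
  mappingCocone.desc _ (dualCochain E (mappingCone.snd (s • 𝟙 A)))
    (Cocycle.mk (dualCochain E (mappingCone.fst (s • 𝟙 A)).1) 2 (by omega) (by
      rw [δ_dualCochain E (by omega), Cocycle.δ_eq_zero, dualCochain_zero])) (by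
      rw [δ_dualCochain E (by omega), mappingCone.δ_snd, ofHom_smul, ofHom_smul]
      simp [dualCochain_smul, dualCochain_neg])

/-- Dualizing the cone of a homothety gives the cocone of the homothety of the dual. -/
noncomputable def homToModuleMappingConeIso (A : CochainComplex (ModuleCat.{u} S) ℤ) (s : S) :
    homToModule (mappingCone (s • 𝟙 A)) E ≅ mappingCocone (s • 𝟙 (homToModule A E)) where
  hom := homToModuleMappingConeHom E A s
  inv := homToModuleMappingConeInv E A s
  hom_inv_id := by
    refine HomologicalComplex.hom_ext _ _ fun p => ?_
    obtain ⟨-, -, -, -, h⟩ := dualCochain_mappingCone_relations E (s • 𝟙 A) p (p + -1) rfl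
    refine Eq.trans ?_ h
    refine (congrArg (· ≫ (homToModuleMappingConeInv E A s).f p)
      (mappingCocone_lift_f _ _ _ _ p (p + -1) rfl)).trans ?_
    rw [← ofHom_homToModuleMap, Cochain.ofHom_v]
    simp [homToModuleMappingConeInv, sub_eq_add_neg]
  inv_hom_id := by
    refine HomologicalComplex.hom_ext _ _ fun p => ?_
    obtain ⟨h1, h2, h3, h4, -⟩ := dualCochain_mappingCone_relations E (s • 𝟙 A) p (p + -1) rfl
    rw [← ofHom_homToModuleMap, Cochain.ofHom_v] at h1 h3
    refine Eq.trans ?_ (mappingCocone.id_X (s • 𝟙 (homToModule A E)) p (p + -1) rfl)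
    refine (congrArg₂ (· ≫ ·) (mappingCocone_desc_f _ _ _ _ p (p + -1) rfl)
      (mappingCocone_lift_f _ _ _ _ p (p + -1) rfl)).trans ?_
    simp [reassoc_of% h1, reassoc_of% h2, reassoc_of% h3, reassoc_of% h4]

end Dual

/-! ### Cohomology of the Hom complex as homotopy classes of morphisms -/

section HomotopyHom

open CochainComplex CochainComplex.HomComplex Pretriangulated

variable {S : Type u} [CommRing S]

/-- The morphisms of degree `n` in the homotopy category. -/
abbrev homotopyHom (P X : CochainComplex (ModuleCat.{u} S) ℤ) (n : ℤ) : Type u :=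
  (HomotopyCategory.quotient _ (ComplexShape.up ℤ)).obj P ⟶
    ((HomotopyCategory.quotient _ (ComplexShape.up ℤ)).obj X)⟦n⟧

/-- The homotopy class of a cocycle. -/
noncomputable def cocycleToHom (P X : CochainComplex (ModuleCat.{u} S) ℤ) (n : ℤ) :
    LinearMap.ker ((homComplex P X).d n (n + 1)).hom →ₗ[S]
      ((HomotopyCategory.quotient _ (ComplexShape.up ℤ)).obj P ⟶
        (HomotopyCategory.quotient _ (ComplexShape.up ℤ)).obj (X⟦n⟧)) where
  toFun z := (HomotopyCategory.quotient _ _).map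
    (Cocycle.equivHomShift.symm (Cocycle.mk z.1 (n + 1) rfl z.2))
  map_add' a b := by
    rw [← Functor.map_add, ← map_add]
    rfl
  map_smul' s a := by
    rw [RingHom.id_apply, ← Functor.map_smul]
    congr 1

lemma cocycleToHom_surjective (P X : CochainComplex (ModuleCat.{u} S) ℤ) (n : ℤ) :
    Function.Surjective (cocycleToHom P X n) := by
  intro f
  obtain ⟨c, rfl⟩ := (CohomologyClass.toHom_bijective P X n).2 f
  obtain ⟨c, rfl⟩ := c.mk_surjective
  exact ⟨⟨c.1, c.δ_eq_zero (n + 1)⟩, rfl⟩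

lemma ker_cocycleToHom (P X : CochainComplex (ModuleCat.{u} S) ℤ) (n : ℤ) :
    LinearMap.ker (cocycleToHom P X n) =
      (LinearMap.range ((homComplex P X).d (n - 1) n).hom).submoduleOf
        (LinearMap.ker ((homComplex P X).d n (n + 1)).hom) := by
  ext z
  refine (CohomologyClass.toHom_mk_eq_zero_iff (Cocycle.mk z.1 (n + 1) rfl z.2)).trans ?_
  exact mem_coboundaries_iff _ (n - 1) (by omega)

/-- The homology of the complex `Hom(P, X)` is given by homotopy classes. -/
noncomputable def homologyHomComplexEquiv (P X : CochainComplex (ModuleCat.{u} S) ℤ) (n : ℤ) :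
    (homComplex P X).homology n ≃ₗ[S] homotopyHom P X n :=
  (homologyEquiv (homComplex P X) (sub_add_cancel n 1) rfl).trans
    ((Submodule.quotEquivOfEq _ _ (ker_cocycleToHom P X n).symm).trans
      (((cocycleToHom P X n).quotKerEquivOfSurjective (cocycleToHom_surjective P X n)).trans
        (Linear.homCongr S (Iso.refl _)
          (((HomotopyCategory.quotient _ (ComplexShape.up ℤ)).commShiftIso n).app X))))

end HomotopyHom

/-! ### Exact sequences of Hom modules from distinguished triangles -/

section Triangles

open Pretriangulated

variable {C : Type*} [Category* C] [Preadditive C] [Limits.HasZeroObject C] [HasShift C ℤ]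
  [∀ n : ℤ, (shiftFunctor C n).Additive] [Pretriangulated C] {S : Type*} [CommRing S] [Linear S C]

lemma exact_hom_obj₂ {T : Triangle C} (hT : T ∈ distTriang C) (P : C) :
    Function.Exact (Linear.rightComp S P T.mor₁) (Linear.rightComp S P T.mor₂) := by
  intro f
  constructor
  · intro hf
    obtain ⟨g, hg⟩ := Triangle.coyoneda_exact₂ T hT f hf
    exact ⟨g, hg.symm⟩
  · rintro ⟨g, rfl⟩
    change (g ≫ T.mor₁) ≫ T.mor₂ = 0
    rw [Category.assoc, comp_distTriang_mor_zero₁₂ T hT, Limits.comp_zero]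

lemma exact_hom_obj₃ {T : Triangle C} (hT : T ∈ distTriang C) (P : C) :
    Function.Exact (Linear.rightComp S P T.mor₂) (Linear.rightComp S P T.mor₃) :=
  exact_hom_obj₂ (rot_of_distTriang _ hT) P

/-- When the first morphism and its shift act as zero on `Hom(P, -)`, the long exact sequence leaves
`0 → Hom(P, T₂) → Hom(P, T₃) → Hom(P, T₁[1]) → 0`. -/
lemma length_hom_obj₃ {T : Triangle C} (hT : T ∈ distTriang C) (P : C)
    (h₁ : ∀ f : P ⟶ T.obj₁, f ≫ T.mor₁ = 0)
    (h₂ : ∀ f : P ⟶ T.obj₁⟦(1 : ℤ)⟧, f ≫ T.mor₁⟦(1 : ℤ)⟧' = 0) :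
    Module.length S (P ⟶ T.obj₃) =
      Module.length S (P ⟶ T.obj₂) + Module.length S (P ⟶ T.obj₁⟦(1 : ℤ)⟧) := by
  refine Module.length_eq_add_of_exact (Linear.rightComp S P T.mor₂)
    (Linear.rightComp S P T.mor₃) ?_ ?_ (exact_hom_obj₃ hT P)
  · rw [injective_iff_map_eq_zero]
    intro f hf
    obtain ⟨g, rfl⟩ := Triangle.coyoneda_exact₂ T hT f hf
    exact h₁ g
  · intro f
    obtain ⟨g, hg⟩ := Triangle.coyoneda_exact₁ T hT f (h₂ f)
    exact ⟨g, hg.symm⟩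

lemma exact_hom_to {T : Triangle C} (hT : T ∈ distTriang C) (X : C) :
    Function.Exact (Linear.leftComp S X T.mor₃) (Linear.leftComp S X T.mor₂) := by
  intro f
  constructor
  · intro hf
    obtain ⟨g, hg⟩ := Triangle.yoneda_exact₃ T hT f hf
    exact ⟨g, hg.symm⟩
  · rintro ⟨g, rfl⟩
    change T.mor₂ ≫ T.mor₃ ≫ g = 0
    rw [comp_distTriang_mor_zero₂₃_assoc T hT, Limits.zero_comp]

end Triangles

/-! ### Homotopy classes of morphisms into the cone of a homothety -/

section HomotopyHom

open CochainComplex CochainComplex.HomComplex Pretriangulated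

variable {S : Type u} [CommRing S]

lemma smul_homotopyHom_eq_zero {X : CochainComplex (ModuleCat.{u} S) ℤ} {s : S}
    (hs : s ∈ homotopyAnnihilator X) (P : CochainComplex (ModuleCat.{u} S) ℤ) (n : ℤ)
    (f : homotopyHom P X n) : s • f = 0 := by
  obtain ⟨h, hh⟩ := hs
  have h1 : (HomotopyCategory.quotient _ (ComplexShape.up ℤ)).map (s • 𝟙 X) = 0 := by
    rw [HomotopyCategory.quotient_map_eq_zero_iff]
    exact ⟨(Cochain.equivHomotopy _ _).symm ⟨h, by simp [hh]⟩⟩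
  rw [Functor.map_smul, CategoryTheory.Functor.map_id] at h1
  have h2 : (s • 𝟙 ((HomotopyCategory.quotient _ (ComplexShape.up ℤ)).obj X))⟦n⟧' = 0 := by
    rw [h1, Functor.map_zero]
  rw [Functor.map_smul, CategoryTheory.Functor.map_id] at h2
  rw [← Category.comp_id f, ← Linear.comp_smul, h2, Limits.comp_zero]

/-- The source of `stepSum`: the triangle of the cone, shifted by `n`, has a first morphism acting
as zero on homotopy classes from `P`. -/
lemma length_homotopyHom_mappingCone (P X : CochainComplex (ModuleCat.{u} S) ℤ) (s : S)
    (hs : ∀ (n : ℤ) (f : homotopyHom P X n), s • f = 0) (n : ℤ) :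
    Module.length S (homotopyHom P (mappingCone (s • 𝟙 X)) n) =
      Module.length S (homotopyHom P X n) + Module.length S (homotopyHom P X (n + 1)) := by
  have hT := Triangle.shift_distinguished _
    (HomotopyCategory.mappingCone_triangleh_distinguished (s • 𝟙 X)) n
  have e : homotopyHom P X (n + 1) ≃ₗ[S]
      ((HomotopyCategory.quotient _ (ComplexShape.up ℤ)).obj P ⟶
        (((HomotopyCategory.quotient _ (ComplexShape.up ℤ)).obj X)⟦n⟧)⟦(1 : ℤ)⟧) :=
    Linear.homCongr S (Iso.refl _) ((shiftFunctorAdd _ n (1 : ℤ)).app _)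
  let Xn := ((HomotopyCategory.quotient _ (ComplexShape.up ℤ)).obj X)⟦n⟧
  -- Shifting a triangle by `n` multiplies its morphisms by `(-1)^n`; up to this sign `g` is still
  -- the homothety `s`.
  let g : Xn ⟶ Xn := n.negOnePow •
    ((HomotopyCategory.quotient _ (ComplexShape.up ℤ)).map (s • 𝟙 X))⟦n⟧'
  have hg : g = n.negOnePow • s • 𝟙 Xn := by
    dsimp only [g, Xn]
    rw [Functor.map_smul, Functor.map_smul]
    simp
  have key (f : (HomotopyCategory.quotient _ (ComplexShape.up ℤ)).obj P ⟶ Xn) : f ≫ g = 0 := by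
    rw [hg, Linear.comp_units_smul, Linear.comp_smul, Category.comp_id, hs n f, smul_zero]
  have key' (f : (HomotopyCategory.quotient _ (ComplexShape.up ℤ)).obj P ⟶ Xn⟦(1 : ℤ)⟧) :
      f ≫ g⟦(1 : ℤ)⟧' = 0 := by
    rw [hg, Functor.map_units_smul, Functor.map_smul, CategoryTheory.Functor.map_id,
      Linear.comp_units_smul, Linear.comp_smul, Category.comp_id,
      ← e.apply_symm_apply (s • f), map_smul, hs, map_zero, smul_zero]
  rw [e.length_eq]
  exact length_hom_obj₃ hT _ key key'

end HomotopyHom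

/-! ### Morphisms out of K-projective complexes: quasi-isomorphism invariance and vanishing -/

section HomotopyHom

open CochainComplex CochainComplex.HomComplex Pretriangulated

variable {S : Type u} [CommRing S]

lemma mem_homotopyAnnihilator_iff_quotient_map (Z : CochainComplex (ModuleCat.{u} S) ℤ) (s : S) :
    s ∈ homotopyAnnihilator Z ↔
      (HomotopyCategory.quotient _ (ComplexShape.up ℤ)).map (s • 𝟙 Z) = 0 := by
  rw [HomotopyCategory.quotient_map_eq_zero_iff]
  constructor
  · rintro ⟨h, hh⟩
    exact ⟨(Cochain.equivHomotopy _ _).symm ⟨h, by simp [hh]⟩⟩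
  · rintro ⟨h⟩
    obtain ⟨γ, hγ⟩ := Cochain.equivHomotopy _ _ h
    exact ⟨γ, by simpa using hγ.symm⟩

lemma smul_homotopyHom_eq_zero_of_left {P : CochainComplex (ModuleCat.{u} S) ℤ} {s : S}
    (hs : s ∈ homotopyAnnihilator P) (X : CochainComplex (ModuleCat.{u} S) ℤ) (n : ℤ)
    (f : homotopyHom P X n) : s • f = 0 := by
  rw [mem_homotopyAnnihilator_iff_quotient_map, Functor.map_smul, CategoryTheory.Functor.map_id]
    at hs
  rw [← Category.id_comp f, ← Linear.smul_comp, hs, Limits.zero_comp]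

/-- A quasi-isomorphism induces an isomorphism on homotopy classes of morphisms from a K-projective
complex. -/
lemma nonempty_homotopyHom_equiv_of_quasiIso (P : CochainComplex (ModuleCat.{u} S) ℤ)
    [P.IsKProjective] {X Y : CochainComplex (ModuleCat.{u} S) ℤ} (f : X ⟶ Y) [QuasiIso f] (n : ℤ) :
    Nonempty (homotopyHom P X n ≃ₗ[S] homotopyHom P Y n) := by
  let := HasDerivedCategory.standard (ModuleCat.{u} S)
  let g := (HomotopyCategory.quotient _ (ComplexShape.up ℤ)).map f
  have h1 : IsIso (DerivedCategory.Qh.map g) := by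
    change IsIso (((HomotopyCategory.quotient _ (ComplexShape.up ℤ)) ⋙ DerivedCategory.Qh).map f)
    rw [NatIso.isIso_map_iff (DerivedCategory.quotientCompQhIso _)]
    infer_instance
  have h2 : IsIso (DerivedCategory.Qh.map (g⟦n⟧')) := by
    change IsIso ((CategoryTheory.shiftFunctor _ n ⋙ DerivedCategory.Qh).map g)
    rw [NatIso.isIso_map_iff (DerivedCategory.Qh.commShiftIso n)]
    dsimp
    infer_instance
  refine ⟨LinearEquiv.ofBijective (Linear.rightComp S _ (g⟦n⟧')) ?_⟩
  -- Out of a K-projective complex, homotopy classes coincide with morphisms in the derived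
  -- category, where `f` is invertible.
  have hP := fun L => IsKProjective.Qh_map_bijective P L
  refine (Function.Bijective.of_comp_iff' (hP _) _).mp ?_
  have h3 : Function.Bijective fun a : DerivedCategory.Qh.obj _ ⟶ DerivedCategory.Qh.obj _ =>
      a ≫ DerivedCategory.Qh.map (g⟦n⟧') :=
    ((asIso (DerivedCategory.Qh.map (g⟦n⟧'))).homToEquiv
      (Z := DerivedCategory.Qh.obj ((HomotopyCategory.quotient _ _).obj P))).bijective
  convert h3.comp (hP _) using 1
  ext a
  exact DerivedCategory.Qh.map_comp _ _

/-- Orthogonality of the t-structure: `P` lives in degrees `≤ 0`, while `X[n]` lives in degrees `≥ b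
- n > 0`. -/
lemma subsingleton_homotopyHom (P : CochainComplex (ModuleCat.{u} S) ℤ) [P.IsKProjective]
    [P.IsStrictlyLE 0] {X : CochainComplex (ModuleCat.{u} S) ℤ} {b : ℤ}
    (hX : ∀ n < b, Subsingleton (X.homology n)) {n : ℤ} (hn : n < b) :
    Subsingleton (homotopyHom P X n) := by
  let := HasDerivedCategory.standard (ModuleCat.{u} S)
  have hGE : X.IsGE b := by
    rw [isGE_iff]
    intro i hi
    rw [HomologicalComplex.exactAt_iff_isZero_homology]
    have := hX i hi
    exact ModuleCat.isZero_of_subsingleton _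
  refine subsingleton_of_forall_eq 0 fun f => ?_
  refine (IsKProjective.Qh_map_bijective P _).injective ?_
  rw [Functor.map_zero]
  let eP := (DerivedCategory.quotientCompQhIso _).app P
  let eX := (DerivedCategory.Qh.commShiftIso n).app ((HomotopyCategory.quotient _ _).obj X) ≪≫
    (CategoryTheory.shiftFunctor _ n).mapIso ((DerivedCategory.quotientCompQhIso _).app X)
  have h : eP.inv ≫ DerivedCategory.Qh.map f ≫ eX.hom = 0 := by
    have h1 : (DerivedCategory.Q.obj P).IsLE 0 := inferInstance
    have h2 : ((DerivedCategory.Q.obj X)⟦n⟧).IsGE (b - n) :=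
      DerivedCategory.TStructure.t.isGE_shift _ b n (b - n)
    exact DerivedCategory.TStructure.t.zero _ 0 (b - n) (by omega)
  rw [← cancel_epi eP.inv, ← cancel_mono eX.hom]
  simpa using h

end HomotopyHom

/-! ### Base change of projective resolutions, and the scalars killing them up to homotopy -/

section BaseChange

open CochainComplex CochainComplex.HomComplex

variable {R S : Type u} [CommRing R] [CommRing S] (φ : R →+* S)

instance : (ModuleCat.extendScalars.{u, u, u} φ).Additive :=
  (ModuleCat.extendRestrictScalarsAdj.{u, u, u} φ).left_adjoint_additive

lemma extendScalars_map_smul {A B : ModuleCat.{u} R} (r : R) (f : A ⟶ B) :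
    (ModuleCat.extendScalars.{u, u, u} φ).map (r • f) =
      φ r • (ModuleCat.extendScalars.{u, u, u} φ).map f := by
  let := φ.toAlgebra
  ext a
  change (1 : S) ⊗ₜ[R] (r • f a) = φ r • ((1 : S) ⊗ₜ[R] f a)
  rw [TensorProduct.tmul_smul]
  rfl

/-- Base change of complexes along `φ`. -/
noncomputable abbrev baseChange (P : CochainComplex (ModuleCat.{u} R) ℤ) :
    CochainComplex (ModuleCat.{u} S) ℤ :=
  ((ModuleCat.extendScalars.{u, u, u} φ).mapHomologicalComplex (ComplexShape.up ℤ)).obj P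

instance (P : CochainComplex (ModuleCat.{u} R) ℤ) [∀ n, Projective (P.X n)] (n : ℤ) :
    Projective ((baseChange φ P).X n) :=
  (ModuleCat.extendRestrictScalarsAdj.{u, u, u} φ).map_projective _ inferInstance

instance (P : CochainComplex (ModuleCat.{u} R) ℤ) (d : ℤ) [P.IsStrictlyLE d] :
    (baseChange φ P).IsStrictlyLE d := inferInstance

instance (L : Type u) [AddCommGroup L] [Module R L] :
    (baseChangeResolution φ L).IsStrictlyLE 0 :=
  inferInstanceAs ((baseChange φ _).IsStrictlyLE 0)

instance (L : Type u) [AddCommGroup L] [Module R L] :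
    (baseChangeResolution φ L).IsKProjective :=
  isKProjective_of_projective (baseChange φ _) 0

lemma map_mem_homotopyAnnihilator_baseChange {P : CochainComplex (ModuleCat.{u} R) ℤ} {r : R}
    (hr : r ∈ homotopyAnnihilator P) : φ r ∈ homotopyAnnihilator (baseChange φ P) := by
  rw [mem_homotopyAnnihilator_iff_quotient_map, HomotopyCategory.quotient_map_eq_zero_iff] at hr ⊢
  obtain ⟨h⟩ := hr
  refine ⟨(Homotopy.ofEq ?_).trans (((ModuleCat.extendScalars.{u, u, u} φ).mapHomotopy h).trans
    (Homotopy.ofEq ?_))⟩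
  · ext n : 1
    simp [extendScalars_map_smul]
    rfl
  · rw [Functor.map_zero]

/-- If `r L = 0`, then `r` is zero on `P` in the derived category, where `P` is isomorphic to `L`;
K-projectivity makes it null-homotopic. -/
lemma mem_homotopyAnnihilator_cochainComplex {L : ModuleCat.{u} R} (P : ProjectiveResolution L)
    {r : R} (hr : r ∈ Module.annihilator R L) : r ∈ homotopyAnnihilator P.cochainComplex := by
  let := HasDerivedCategory.standard (ModuleCat.{u} R)
  rw [mem_homotopyAnnihilator_iff_quotient_map]
  refine (IsKProjective.Qh_map_bijective P.cochainComplex _).injective ?_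
  have h1 : DerivedCategory.Q.map (r • 𝟙 P.cochainComplex) = 0 := by
    rw [← cancel_mono (DerivedCategory.Q.map P.π'), ← Functor.map_comp, Limits.zero_comp]
    have h2 : r • 𝟙 L = 0 := by
      ext a
      exact Module.mem_annihilator.mp hr a
    have h3 : (r • 𝟙 P.cochainComplex) ≫ P.π' = 0 := by
      rw [Linear.smul_comp, Category.id_comp, ← Category.comp_id P.π', ← Linear.comp_smul,
        ← CategoryTheory.Functor.map_id, ← Functor.map_smul, h2, Functor.map_zero,
        Limits.comp_zero]
    rw [h3, Functor.map_zero]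
  rw [Functor.map_zero]
  have h4 := (DerivedCategory.quotientCompQhIso _).hom.naturality (r • 𝟙 P.cochainComplex)
  rw [h1, Limits.comp_zero] at h4
  exact (cancel_mono _).mp (h4.trans Limits.zero_comp.symm)

lemma map_mem_homotopyAnnihilator_baseChangeResolution {L : Type u} [AddCommGroup L] [Module R L]
    {r : R} (hr : r ∈ Module.annihilator R L) :
    φ r ∈ homotopyAnnihilator (baseChangeResolution φ L) :=
  map_mem_homotopyAnnihilator_baseChange φ
    (mem_homotopyAnnihilator_cochainComplex (L := ModuleCat.of R L) _ hr)

end BaseChange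

/-! ### Morphisms from a projective module placed in one degree -/

section SingleProjective

open CochainComplex CochainComplex.HomComplex

variable {S : Type u} [CommRing S]

lemma single_smul {K L : CochainComplex (ModuleCat.{u} S) ℤ} {p q : ℤ} (s : S)
    (f : K.X p ⟶ L.X q) (n : ℤ) : Cochain.single (s • f) n = s • Cochain.single f n := by
  ext p' q' h : 2
  rw [Cochain.smul_v]
  by_cases h' : p' = p
  · subst h'
    by_cases h'' : q' = q
    · subst h''
      rw [Cochain.single_v, Cochain.single_v]
    · rw [Cochain.single_v_eq_zero' _ _ _ _ _ h'', Cochain.single_v_eq_zero' _ _ _ _ _ h'',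
        smul_zero]
  · rw [Cochain.single_v_eq_zero _ _ _ _ _ h', Cochain.single_v_eq_zero _ _ _ _ _ h', smul_zero]

lemma fromSingleMk_smul {A : ModuleCat.{u} S} {X : CochainComplex (ModuleCat.{u} S) ℤ} {p q n : ℤ}
    (s : S) (f : A ⟶ X.X q) (h : p + n = q) :
    Cochain.fromSingleMk (s • f) h = s • Cochain.fromSingleMk f h := by
  refine Eq.trans ?_ (single_smul _ _ _)
  exact congrArg (fun g => Cochain.single g n) (Linear.comp_smul _ _ _ _ _ _)

/-- The cochain given by a morphism out of a module, as a linear map. -/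
noncomputable def fromSingleLinearMap (A : ModuleCat.{u} S)
    (X : CochainComplex (ModuleCat.{u} S) ℤ) (n : ℤ) :
    (A ⟶ X.X n) →ₗ[S] Cochain ((singleFunctor _ 0).obj A) X n where
  toFun f := Cochain.fromSingleMk f (zero_add n)
  map_add' f g := Cochain.fromSingleMk_add f g (zero_add n)
  map_smul' s f := fromSingleMk_smul s f (zero_add n)

/-- The morphism to a module given by a linear map to a submodule. -/
noncomputable def homOfSubmodule (A B : ModuleCat.{u} S) (V : Submodule S B) :
    (A →ₗ[S] V) →ₗ[S] (A ⟶ B) where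
  toFun f := ModuleCat.ofHom (V.subtype ∘ₗ f)
  map_add' _ _ := rfl
  map_smul' _ _ := rfl

lemma comp_d_eq_zero {A : ModuleCat.{u} S} {X : CochainComplex (ModuleCat.{u} S) ℤ} {n : ℤ}
    (f : A →ₗ[S] LinearMap.ker (X.d n (n + 1)).hom) :
    ModuleCat.ofHom ((LinearMap.ker (X.d n (n + 1)).hom).subtype ∘ₗ f) ≫ X.d n (n + 1) = 0 := by
  ext a
  exact (f a).2

/-- The homotopy class of a morphism from a module to the cycles of a complex. -/
noncomputable def cyclesToHom (A : ModuleCat.{u} S) (X : CochainComplex (ModuleCat.{u} S) ℤ)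
    (n : ℤ) :
    (A →ₗ[S] LinearMap.ker (X.d n (n + 1)).hom) →ₗ[S]
      ((HomotopyCategory.quotient _ (ComplexShape.up ℤ)).obj ((singleFunctor _ 0).obj A) ⟶
        (HomotopyCategory.quotient _ (ComplexShape.up ℤ)).obj (X⟦n⟧)) :=
  cocycleToHom ((singleFunctor _ 0).obj A) X n ∘ₗ
    (fromSingleLinearMap A X n ∘ₗ homOfSubmodule A (X.X n) _).codRestrict
      (LinearMap.ker ((homComplex ((singleFunctor _ 0).obj A) X).d n (n + 1)).hom)
      fun f => (Cochain.δ_fromSingleMk (K := X) _ (zero_add n) (n + 1) (n + 1) (zero_add _)).trans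
        ((congrArg (fun g => Cochain.fromSingleMk (K := X) g (zero_add (n + 1)))
          (comp_d_eq_zero f)).trans (Cochain.fromSingleMk_zero A X 0 (n + 1) (n + 1) (zero_add _)))

lemma cyclesToHom_apply (A : ModuleCat.{u} S) (X : CochainComplex (ModuleCat.{u} S) ℤ) (n : ℤ)
    (f : A →ₗ[S] LinearMap.ker (X.d n (n + 1)).hom)
    (hf : ModuleCat.ofHom ((LinearMap.ker (X.d n (n + 1)).hom).subtype ∘ₗ f) ≫
      X.d n (n + 1) = 0) :
    cyclesToHom A X n f = CohomologyClass.toHom (CohomologyClass.mk (Cocycle.fromSingleMk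
      (ModuleCat.ofHom ((LinearMap.ker (X.d n (n + 1)).hom).subtype ∘ₗ f)) (zero_add n)
      (n + 1) rfl hf)) := rfl

lemma cyclesToHom_surjective (A : ModuleCat.{u} S) (X : CochainComplex (ModuleCat.{u} S) ℤ)
    (n : ℤ) : Function.Surjective (cyclesToHom A X n) := by
  intro g
  obtain ⟨c, rfl⟩ := (CohomologyClass.toHom_bijective _ X n).2 g
  obtain ⟨c, rfl⟩ := c.mk_surjective
  obtain ⟨f, hf, rfl⟩ := Cocycle.fromSingleMk_surjective c n (zero_add n) (n + 1) rfl
  exact ⟨f.hom.codRestrict _ fun a => ConcreteCategory.congr_hom hf a, rfl⟩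

/-- Projectivity lifts a map with values in boundaries through the differential, and the lift is a
null-homotopy. -/
lemma cyclesToHom_eq_zero {A : ModuleCat.{u} S} [Module.Projective S A]
    {X : CochainComplex (ModuleCat.{u} S) ℤ} {n : ℤ}
    {f : A →ₗ[S] LinearMap.ker (X.d n (n + 1)).hom}
    (hf : ∀ a, (f a).1 ∈ LinearMap.range (X.d (n - 1) n).hom) : cyclesToHom A X n f = 0 := by
  rw [cyclesToHom_apply A X n f (comp_d_eq_zero f), CohomologyClass.toHom_mk_eq_zero_iff,
    Cocycle.fromSingleMk_mem_coboundaries_iff _ _ _ _ _ (n - 1) (by omega)]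
  obtain ⟨g, hg⟩ := Module.projective_lifting_property (X.d (n - 1) n).hom.rangeRestrict
    (((LinearMap.ker (X.d n (n + 1)).hom).subtype ∘ₗ f).codRestrict _ hf)
    (LinearMap.surjective_rangeRestrict _)
  refine ⟨ModuleCat.ofHom g, ?_⟩
  ext a
  exact congrArg Subtype.val (LinearMap.congr_fun hg a)

/-- A class is determined by the homology classes of the images of `m` generators of `A`; the module
is thus a quotient of a submodule of `H^n(X)^m`. -/
lemma finite_homotopyHom_single [IsNoetherianRing S] (A : ModuleCat.{u} S) [Module.Finite S A]
    [Module.Projective S A] (X : CochainComplex (ModuleCat.{u} S) ℤ) (n : ℤ)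
    [Module.Finite S (X.homology n)] :
    Module.Finite S (homotopyHom ((singleFunctor _ 0).obj A) X n) := by
  obtain ⟨m, a, ha⟩ := Module.Finite.exists_fin (R := S) (M := A)
  let B := (LinearMap.range (X.d (n - 1) n).hom).submoduleOf (LinearMap.ker (X.d n (n + 1)).hom)
  have hB : Module.Finite S (_ ⧸ B) :=
    Module.Finite.equiv (homologyEquiv X (sub_add_cancel n 1) rfl)
  let β : (A →ₗ[S] LinearMap.ker (X.d n (n + 1)).hom) →ₗ[S] (Fin m → _ ⧸ B) :=
    LinearMap.pi fun i => B.mkQ ∘ₗ LinearMap.applyₗ (a i)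
  have hβ : LinearMap.ker β ≤ LinearMap.ker (cyclesToHom A X n) := by
    intro f hf
    refine cyclesToHom_eq_zero fun v => ?_
    have h1 : Submodule.span S (Set.range a) ≤ B.comap f := by
      rw [Submodule.span_le]
      rintro _ ⟨i, rfl⟩
      exact (Submodule.Quotient.mk_eq_zero B).mp (show B.mkQ (f (a i)) = 0 from congrFun hf i)
    exact h1 (ha ▸ Submodule.mem_top)
  have h2 : Module.Finite S (_ ⧸ LinearMap.ker β) :=
    Module.Finite.equiv β.quotKerEquivRange.symm
  have h3 : Module.Finite S ((HomotopyCategory.quotient _ (ComplexShape.up ℤ)).obj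
      ((singleFunctor _ 0).obj A) ⟶ (HomotopyCategory.quotient _ (ComplexShape.up ℤ)).obj (X⟦n⟧)) :=
    Module.Finite.of_surjective ((LinearMap.ker β).liftQ _ hβ) (by
      intro g
      obtain ⟨f, rfl⟩ := cyclesToHom_surjective A X n g
      exact ⟨(LinearMap.ker β).mkQ f, rfl⟩)
  exact h3.equiv (Linear.homCongr S (Iso.refl _)
    (((HomotopyCategory.quotient _ (ComplexShape.up ℤ)).commShiftIso n).app X))

end SingleProjective

/-! ### Finite generation of Ext by dimension shifting -/

section Finiteness

open CochainComplex CochainComplex.HomComplex Pretriangulated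

variable {R S : Type u} [CommRing R] [CommRing S] (φ : R →+* S)

/-- Morphisms out of left orthogonal objects lift uniquely from the derived category, so an
isomorphism and its inverse lift too. Orthogonality is stated for objects of the homotopy category
because a cone obtained there comes without a chosen complex. -/
lemma nonempty_iso_of_leftOrthogonal [HasDerivedCategory (ModuleCat.{u} R)]
    {C D : HomotopyCategory (ModuleCat.{u} R) (.up ℤ)}
    (hC : (HomotopyCategory.subcategoryAcyclic (ModuleCat.{u} R)).leftOrthogonal C)
    (hD : (HomotopyCategory.subcategoryAcyclic (ModuleCat.{u} R)).leftOrthogonal D)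
    (e : DerivedCategory.Qh.obj C ≅ DerivedCategory.Qh.obj D) : Nonempty (C ≅ D) := by
  have bC := fun X => hC.map_bijective_of_isTriangulated DerivedCategory.Qh X
  have bD := fun X => hD.map_bijective_of_isTriangulated DerivedCategory.Qh X
  obtain ⟨f, hf⟩ := (bC D).2 e.hom
  obtain ⟨g, hg⟩ := (bD C).2 e.inv
  exact ⟨f, g, (bC C).1 (by simp [hf, hg]), (bD D).1 (by simp [hf, hg])⟩

/-- A projective resolution is isomorphic to the resolved object in the derived category. -/
noncomputable def qhProjectiveResolutionIso [HasDerivedCategory (ModuleCat.{u} R)]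
    {L : ModuleCat.{u} R} (P : ProjectiveResolution L) :
    DerivedCategory.Qh.obj ((HomotopyCategory.quotient _ (.up ℤ)).obj P.cochainComplex) ≅
      (DerivedCategory.singleFunctor _ 0).obj L :=
  (DerivedCategory.quotientCompQhIso _).app P.cochainComplex ≪≫
    asIso (DerivedCategory.Q.map P.π') ≪≫
      (DerivedCategory.singleFunctorIsoCompQ _ 0).symm.app L

lemma isKProjective_single (F : ModuleCat.{u} R) [Projective F] :
    ((singleFunctor (ModuleCat.{u} R) 0).obj F).IsKProjective := by
  have (n : ℤ) : Projective (((singleFunctor (ModuleCat.{u} R) 0).obj F).X n) := by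
    by_cases hn : n = 0
    · subst hn
      exact Projective.of_iso (HomologicalComplex.singleObjXSelf (.up ℤ) 0 F).symm inferInstance
    · exact (HomologicalComplex.isZero_single_obj_X _ _ _ _ hn).projective
  exact isKProjective_of_projective _ 0

/-- A short exact sequence `0 → L' → F → L → 0` with `F` projective gives a distinguished triangle
relating projective resolutions of `L'` and `L` to `F`. -/
lemma exists_distinguished_of_shortExact {T : ShortComplex (ModuleCat.{u} R)} (hT : T.ShortExact)
    [Projective T.X₂] (P₁ : ProjectiveResolution T.X₁) (P₃ : ProjectiveResolution T.X₃) :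
    ∃ (f : (HomotopyCategory.quotient _ (.up ℤ)).obj P₁.cochainComplex ⟶
        (HomotopyCategory.quotient _ (.up ℤ)).obj ((singleFunctor _ 0).obj T.X₂))
      (g : (HomotopyCategory.quotient _ (.up ℤ)).obj ((singleFunctor _ 0).obj T.X₂) ⟶
        (HomotopyCategory.quotient _ (.up ℤ)).obj P₃.cochainComplex)
      (h : (HomotopyCategory.quotient _ (.up ℤ)).obj P₃.cochainComplex ⟶
        ((HomotopyCategory.quotient _ (.up ℤ)).obj P₁.cochainComplex)⟦(1 : ℤ)⟧),
      Triangle.mk f g h ∈ distTriang _ := by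
  let := HasDerivedCategory.standard (ModuleCat.{u} R)
  have hF := isKProjective_single T.X₂
  let e₂ : DerivedCategory.Qh.obj ((HomotopyCategory.quotient _ (.up ℤ)).obj
      ((singleFunctor _ 0).obj T.X₂)) ≅ (DerivedCategory.singleFunctor _ 0).obj T.X₂ :=
    (DerivedCategory.quotientCompQhIso _).app ((singleFunctor _ 0).obj T.X₂) ≪≫
      (DerivedCategory.singleFunctorIsoCompQ _ 0).symm.app T.X₂
  obtain ⟨f, hf⟩ := (IsKProjective.Qh_map_bijective P₁.cochainComplex
    ((HomotopyCategory.quotient _ (.up ℤ)).obj ((singleFunctor _ 0).obj T.X₂))).2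
    ((qhProjectiveResolutionIso P₁).hom ≫ (DerivedCategory.singleFunctor _ 0).map T.f ≫ e₂.inv)
  -- The third vertex becomes `T.X₃` in the derived category, by comparison with the triangle of the
  -- short exact sequence; being left orthogonal, it is then isomorphic to the given resolution.
  obtain ⟨C, g, h, hC⟩ := distinguished_cocone_triangle f
  have hC' : (HomotopyCategory.subcategoryAcyclic (ModuleCat.{u} R)).leftOrthogonal C :=
    ObjectProperty.ext_of_isTriangulatedClosed₃ _ _ hC
      (IsKProjective.leftOrthogonal P₁.cochainComplex) (IsKProjective.leftOrthogonal _)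
  let e₃ := Triangle.π₃.mapIso (isoTriangleOfIso₁₂ _ _
    (DerivedCategory.Qh.map_distinguished _ hC) hT.singleTriangle_distinguished
    (qhProjectiveResolutionIso P₁) e₂ (by
      change DerivedCategory.Qh.map f ≫ e₂.hom = _ ≫ (DerivedCategory.singleFunctor _ 0).map T.f
      rw [hf, Category.assoc, Category.assoc, e₂.inv_hom_id, Category.comp_id]))
  obtain ⟨e⟩ := nonempty_iso_of_leftOrthogonal hC'
    (IsKProjective.leftOrthogonal P₃.cochainComplex) (e₃ ≪≫ (qhProjectiveResolutionIso P₃).symm)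
  exact ⟨f, g ≫ e.hom, e.inv ≫ h, isomorphic_distinguished _ hC _
    (Triangle.isoMk (Triangle.mk f (g ≫ e.hom) (e.inv ≫ h)) (Triangle.mk f g h) (Iso.refl _)
      (Iso.refl _) e.symm ((Category.comp_id _).trans (Category.id_comp _).symm)
      (by
        exact (Category.assoc _ _ _).trans ((congrArg (g ≫ ·) e.hom_inv_id).trans
          ((Category.comp_id g).trans (Category.id_comp g).symm)))
      (by
        change (e.inv ≫ h) ≫ (𝟙 _)⟦(1 : ℤ)⟧' = e.inv ≫ h
        simp))⟩

lemma finite_of_exact [IsNoetherianRing S] {A B C : Type*} [AddCommGroup A] [AddCommGroup B]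
    [AddCommGroup C] [Module S A] [Module S B] [Module S C] {f : A →ₗ[S] B} {g : B →ₗ[S] C}
    (h : Function.Exact f g) (hA : Module.Finite S A) (hC : Module.Finite S C) :
    Module.Finite S B := by
  have := isNoetherian_of_range_eq_ker f g (LinearMap.exact_iff.mp h).symm
  infer_instance

lemma finite_hom_shift {C : Type*} [Category* C] [Preadditive C] [HasShift C ℤ] [Linear S C]
    [∀ n : ℤ, (CategoryTheory.shiftFunctor C n).Additive]
    [∀ n : ℤ, (CategoryTheory.shiftFunctor C n).Linear S] (a b c : ℤ) (h : a + b = c) (A B : C)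
    [Module.Finite S (A ⟶ B⟦a⟧)] : Module.Finite S (A⟦b⟧ ⟶ B⟦c⟧) := by
  let f : (A ⟶ B⟦a⟧) →ₗ[S] (A⟦b⟧ ⟶ B⟦a⟧⟦b⟧) := (CategoryTheory.shiftFunctor C b).mapLinearMap S
  have hf : Function.Surjective f := (CategoryTheory.shiftFunctor C b).map_surjective
  have := Module.Finite.of_surjective f hf
  exact this.equiv (Linear.homCongr S (Iso.refl (A⟦b⟧))
    ((CategoryTheory.shiftFunctorAdd' C a b c h).symm.app B))

lemma finite_homotopyHom_baseChange_single [IsNoetherianRing S] (F : ModuleCat.{u} R)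
    [Module.Finite R F] [Module.Projective R F] (X : CochainComplex (ModuleCat.{u} S) ℤ) (n : ℤ)
    [Module.Finite S (X.homology n)] :
    Module.Finite S (homotopyHom (baseChange φ ((singleFunctor _ 0).obj F)) X n) := by
  let := φ.toAlgebra
  have h1 : Module.Finite S ((ModuleCat.extendScalars.{u, u, u} φ).obj F) :=
    inferInstanceAs (Module.Finite S (S ⊗[R] F))
  have h2 : Module.Projective S ((ModuleCat.extendScalars.{u, u, u} φ).obj F) :=
    inferInstanceAs (Module.Projective S (S ⊗[R] F))
  have h3 := finite_homotopyHom_single ((ModuleCat.extendScalars.{u, u, u} φ).obj F) X n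
  exact h3.equiv (Linear.homCongr S ((HomotopyCategory.quotient _ _).mapIso
    ((HomologicalComplex.singleMapHomologicalComplex (ModuleCat.extendScalars.{u, u, u} φ)
      (ComplexShape.up ℤ) 0).app F).symm) (Iso.refl _))

/-- `Ext` of a finitely generated module into a complex with finitely generated homology
is finitely generated. -/
lemma finite_homotopyHom_baseChange [IsNoetherianRing R] [IsNoetherianRing S]
    {X : CochainComplex (ModuleCat.{u} S) ℤ} {b : ℤ} (hX : ∀ n < b, Subsingleton (X.homology n))
    (hf : ∀ n, Module.Finite S (X.homology n)) (n : ℤ) {L : ModuleCat.{u} R}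
    [Module.Finite R L] (P : ProjectiveResolution L) :
    Module.Finite S (homotopyHom (baseChange φ P.cochainComplex) X n) := by
  have hP (L : ModuleCat.{u} R) (P : ProjectiveResolution L) :
      (baseChange φ P.cochainComplex).IsKProjective := isKProjective_of_projective _ 0
  -- Induction on the distance of `n` above `b`, for all modules at once: below `b` everything
  -- vanishes, and passing to a syzygy lowers `n` by one.
  suffices H : ∀ (k : ℕ) (n : ℤ), n < b + k → ∀ (L : ModuleCat.{u} R), Module.Finite R L →
      ∀ P : ProjectiveResolution L,
        Module.Finite S (homotopyHom (baseChange φ P.cochainComplex) X n) from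
    H (n - b + 1).toNat n (by omega) L inferInstance P
  intro k
  induction k with
  | zero =>
    intro n hn L _ P
    have := subsingleton_homotopyHom (baseChange φ P.cochainComplex) hX (n := n) (by simpa using hn)
    infer_instance
  | succ k ih =>
    intro n hn L _ P
    obtain ⟨m, π, hπ⟩ := Module.Finite.exists_fin' R L
    have hT := LinearMap.shortExact_shortComplexKer hπ
    obtain ⟨f, g, h, hd⟩ := exists_distinguished_of_shortExact hT (projectiveResolution _) P
    have hd' := ((ModuleCat.extendScalars.{u, u, u} φ).mapHomotopyCategory
      (ComplexShape.up ℤ)).map_distinguished _ hd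
    have hex := exact_hom_to (S := S) hd'
      (((HomotopyCategory.quotient _ (ComplexShape.up ℤ)).obj X)⟦n⟧)
    have h1 := ih (n - 1) (by push_cast at hn; omega) _ (inferInstanceAs
      (Module.Finite R (LinearMap.ker π))) (projectiveResolution (ModuleCat.of R (LinearMap.ker π)))
    have h2 : Module.Finite S
        (homotopyHom (baseChange φ ((singleFunctor _ 0).obj (ModuleCat.of R (Fin m → R)))) X n) :=
      finite_homotopyHom_baseChange_single φ _ X n
    have h3 : Module.Finite S
        ((((HomotopyCategory.quotient _ (ComplexShape.up ℤ)).obj (baseChange φ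
          (projectiveResolution (ModuleCat.of R (LinearMap.ker π))).cochainComplex))⟦(1 : ℤ)⟧) ⟶
        ((HomotopyCategory.quotient _ (ComplexShape.up ℤ)).obj X)⟦n⟧) :=
      finite_hom_shift (S := S) (n - 1) 1 n (by omega) _ _
    exact finite_of_exact hex h3 h2

end Finiteness

/-! ### Tensor-hom adjunction for complexes, with signs -/

section TensorHom

open CochainComplex CochainComplex.HomComplex HomologicalComplex

variable {S : Type u} [CommRing S]

/-- The inclusion of a summand of the tensor product of two complexes. -/
noncomputable def tensorInclusion (P X : CochainComplex (ModuleCat.{u} S) ℤ) (p q j : ℤ)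
    (h : p + q = j) : P.X p ⊗[S] X.X q →ₗ[S] (tensorObj P X).X j :=
  (ιTensorObj P X p q j h).hom

lemma d_tensorInclusion (P X : CochainComplex (ModuleCat.{u} S) ℤ) {p q j p' q' j' : ℤ}
    (h : p + q = j) (hp : p + 1 = p') (hq : q + 1 = q') (hj : j + 1 = j') (a : P.X p) (x : X.X q) :
    (tensorObj P X).d j j' (tensorInclusion P X p q j h (a ⊗ₜ x)) =
      tensorInclusion P X p' q j' (by omega) (P.d p p' a ⊗ₜ x) +
        p.negOnePow • tensorInclusion P X p q' j' (by omega) (a ⊗ₜ X.d q q' x) := by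
  have h1 : ιTensorObj P X p q j h ≫ (tensorObj P X).d j j' =
      mapBifunctor.d₁ P X (MonoidalCategory.curriedTensor (ModuleCat.{u} S)) (.up ℤ) p q j' +
        mapBifunctor.d₂ P X (MonoidalCategory.curriedTensor (ModuleCat.{u} S)) (.up ℤ) p q j' := by
    rw [mapBifunctor.d_eq, Preadditive.comp_add, mapBifunctor.ι_D₁, mapBifunctor.ι_D₂]
  refine (ConcreteCategory.congr_hom h1 (a ⊗ₜ[S] x)).trans ?_
  refine Eq.trans (LinearMap.add_apply (ModuleCat.Hom.hom _) (ModuleCat.Hom.hom _) _) ?_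
  refine congrArg₂ (· + ·) ?_ ?_
  · refine (ConcreteCategory.congr_hom (mapBifunctor.d₁_eq (c₁ := ComplexShape.up ℤ) P X
      (MonoidalCategory.curriedTensor (ModuleCat.{u} S)) (.up ℤ) hp q j'
      (show p' + q = j' by omega)) (a ⊗ₜ[S] x)).trans ?_
    exact one_smul ℤˣ _
  · exact ConcreteCategory.congr_hom (mapBifunctor.d₂_eq (c₂ := ComplexShape.up ℤ) P X
      (MonoidalCategory.curriedTensor (ModuleCat.{u} S)) (.up ℤ) p hq j'
      (show p + q' = j' by omega)) (a ⊗ₜ[S] x)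

lemma tensorObj_hom_ext {P X : CochainComplex (ModuleCat.{u} S) ℤ} {j : ℤ} {E : Type u}
    [AddCommGroup E] [Module S E] {f g : (tensorObj P X).X j →ₗ[S] E}
    (h : ∀ p q (h : p + q = j), f ∘ₗ tensorInclusion P X p q j h =
      g ∘ₗ tensorInclusion P X p q j h) : f = g := by
  have : ModuleCat.ofHom f = ModuleCat.ofHom g := mapBifunctor.hom_ext fun p q hpq =>
    ModuleCat.hom_ext (h p q hpq)
  exact congrArg ModuleCat.Hom.hom this

lemma exists_tensorObj_desc {P X : CochainComplex (ModuleCat.{u} S) ℤ} {j : ℤ} {E : Type u}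
    [AddCommGroup E] [Module S E] (f : ∀ p q : ℤ, p + q = j → (P.X p ⊗[S] X.X q →ₗ[S] E)) :
    ∃ g : (tensorObj P X).X j →ₗ[S] E, ∀ p q h, g ∘ₗ tensorInclusion P X p q j h = f p q h := by
  refine ⟨(mapBifunctorDesc (K₁ := P) (K₂ := X)
    (F := MonoidalCategory.curriedTensor (ModuleCat.{u} S)) (c := .up ℤ) (A := ModuleCat.of S E)
    (j := j) fun p q h => ModuleCat.ofHom (f p q h)).hom, fun p q h => ?_⟩
  exact congrArg ModuleCat.Hom.hom (ι_mapBifunctorDesc (K₁ := P) (K₂ := X)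
    (F := MonoidalCategory.curriedTensor (ModuleCat.{u} S)) (c := .up ℤ) (A := ModuleCat.of S E)
    (j := j) (fun p q h => ModuleCat.ofHom (f p q h)) p q h)

variable (E : Type u) [AddCommGroup E] [Module S E]

/-- The cochain associated with a linear form on the tensor product by currying. -/
noncomputable def curryCochain (P X : CochainComplex (ModuleCat.{u} S) ℤ) (n : ℤ) :
    ((tensorObj P X).X (-n) →ₗ[S] E) →ₗ[S] Cochain P (homToModule X E) n where
  toFun f := Cochain.mk fun p q h => ModuleCat.ofHom
    (TensorProduct.curry (f ∘ₗ tensorInclusion P X p (-q) (-n) (by omega)))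
  map_add' f g := rfl
  map_smul' s f := rfl

lemma curryCochain_bijective (P X : CochainComplex (ModuleCat.{u} S) ℤ) (n : ℤ) :
    Function.Bijective (curryCochain E P X n) := by
  constructor
  · intro f g hfg
    refine tensorObj_hom_ext fun p q h => TensorProduct.ext' fun a x => ?_
    obtain ⟨q, rfl⟩ : ∃ q', q = -q' := ⟨-q, by simp⟩
    have h1 := Cochain.congr_v hfg p q (by omega)
    exact LinearMap.congr_fun (ConcreteCategory.congr_hom h1 a :) x
  · intro γ
    obtain ⟨g, hg⟩ := exists_tensorObj_desc (P := P) (X := X) (j := -n) (E := E)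
      fun p q h => TensorProduct.lift
        ((LinearMap.lcomp S E (eqToHom (by rw [neg_neg]) : X.X q ⟶ X.X (-(-q))).hom) ∘ₗ
          (γ.v p (-q) (by omega)).hom)
    refine ⟨g, ?_⟩
    refine Cochain.ext _ _ fun p q h => ModuleCat.hom_ext (LinearMap.ext
      fun (a : P.X p) => LinearMap.ext fun (x : X.X (-q)) => ?_)
    refine (LinearMap.congr_fun (hg p (-q) (by omega)) (a ⊗ₜ x)).trans ?_
    have key : ∀ (q' : ℤ) (hq : q' = q) (h' : p + n = q'),
        (show X.X (-q') →ₗ[S] E from γ.v p q' h' a)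
          ((eqToHom (by rw [hq]) : X.X (-q) ⟶ X.X (-q')) x) =
        (show X.X (-q) →ₗ[S] E from γ.v p q h a) x := by
      rintro q' rfl h'
      rfl
    exact key (-(-q)) (by simp) (by omega)

lemma δ_curryCochain (P X : CochainComplex (ModuleCat.{u} S) ℤ) {n m : ℤ} (h : n + 1 = m)
    (f : (tensorObj P X).X (-n) →ₗ[S] E) :
    δ n m (curryCochain E P X n f) = curryCochain E P X m
      (m.negOnePow • (f ∘ₗ ((tensorObj P X).d (-m) (-n)).hom)) := by
  refine Cochain.ext _ _ fun p q hpq => ModuleCat.hom_ext (LinearMap.ext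
    fun (a : P.X p) => LinearMap.ext fun (x : X.X (-q)) => ?_)
  rw [δ_v n m h _ p q hpq (q - 1) (p + 1) rfl rfl]
  change q.negOnePow • f (tensorInclusion P X p (-(q - 1)) (-n) (by omega)
      (a ⊗ₜ X.d (-q) (-(q - 1)) x)) +
    m.negOnePow • f (tensorInclusion P X (p + 1) (-q) (-n) (by omega) (P.d p (p + 1) a ⊗ₜ x)) =
    m.negOnePow • f ((tensorObj P X).d (-m) (-n)
      (tensorInclusion P X p (-q) (-m) (by omega) (a ⊗ₜ x)))
  rw [d_tensorInclusion P X _ rfl (show -q + 1 = -(q - 1) by omega) (by omega), map_add, smul_add,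
    add_comm]
  have h0 : ∀ b, f (p.negOnePow • b) = p.negOnePow • f b := fun b => by
    rw [Units.smul_def, Units.smul_def, map_zsmul]
  -- Here `p + m = q`, so the sign in the differential of `Hom(X, E)` agrees with the Leibniz sign
  -- `(-1)^p` times `(-1)^m`; currying needs no further sign.
  have h1 : q.negOnePow = (m + p).negOnePow := by rw [← hpq, add_comm]
  rw [h0, smul_smul, ← Int.negOnePow_add, h1]

/-- Tensor-hom adjunction for complexes with values in a module. -/
noncomputable def homToModuleTensorIso (P X : CochainComplex (ModuleCat.{u} S) ℤ) :
    homToModule (tensorObj P X) E ≅ homComplex P (homToModule X E) :=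
  Hom.isoOfComponents
    (fun n => (LinearEquiv.ofBijective _ (curryCochain_bijective E P X n)).toModuleIso)
    (fun n m h => by
      refine ModuleCat.hom_ext (LinearMap.ext fun (f : (tensorObj P X).X (-n) →ₗ[S] E) => ?_)
      exact δ_curryCochain E P X h f)

end TensorHom

/-! ### Ext and Tor with values in complexes of `S`-modules -/

section ExtModules

open CochainComplex CochainComplex.HomComplex

variable {R S : Type u} [CommRing R] [CommRing S] (φ : R →+* S) (L : Type u) [AddCommGroup L]
  [Module R L]

lemma nonempty_extModule_equiv (X : CochainComplex (ModuleCat.{u} S) ℤ) (n : ℤ) :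
    Nonempty (extModule φ L X n ≃ₗ[S] homotopyHom (baseChangeResolution φ L) X n) := by
  have h : ∀ m : ℤ, m = n → Nonempty ((homComplex (baseChangeResolution φ L) X).homology m ≃ₗ[S]
      homotopyHom (baseChangeResolution φ L) X n) := by
    rintro m rfl
    exact ⟨homologyHomComplexEquiv _ _ _⟩
  exact h _ (neg_neg n)

lemma homotopyAnnihilator_le_annihilator_extModule (X : CochainComplex (ModuleCat.{u} S) ℤ)
    (n : ℤ) : homotopyAnnihilator X ≤ Module.annihilator S (extModule φ L X n) := by
  obtain ⟨e⟩ := nonempty_extModule_equiv φ L X n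
  intro s hs
  rw [e.annihilator_eq, Module.mem_annihilator]
  exact smul_homotopyHom_eq_zero hs _ n

lemma map_annihilator_le_annihilator_extModule (X : CochainComplex (ModuleCat.{u} S) ℤ) (n : ℤ) :
    (Module.annihilator R L).map φ ≤ Module.annihilator S (extModule φ L X n) := by
  obtain ⟨e⟩ := nonempty_extModule_equiv φ L X n
  rw [Ideal.map_le_iff_le_comap]
  intro r hr
  rw [Ideal.mem_comap, e.annihilator_eq, Module.mem_annihilator]
  exact smul_homotopyHom_eq_zero_of_left
    (map_mem_homotopyAnnihilator_baseChangeResolution φ hr) _ n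

lemma length_extModule_of_quasiIso {X Y : CochainComplex (ModuleCat.{u} S) ℤ} (f : X ⟶ Y)
    [QuasiIso f] (n : ℤ) :
    Module.length S (extModule φ L X n) = Module.length S (extModule φ L Y n) := by
  obtain ⟨e⟩ := nonempty_extModule_equiv φ L X n
  obtain ⟨e'⟩ := nonempty_extModule_equiv φ L Y n
  obtain ⟨e''⟩ := nonempty_homotopyHom_equiv_of_quasiIso (baseChangeResolution φ L) f n
  exact (e.trans (e''.trans e'.symm)).length_eq

lemma length_extModule_shift (X : CochainComplex (ModuleCat.{u} S) ℤ) (a n : ℤ) :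
    Module.length S (extModule φ L (X⟦a⟧) n) = Module.length S (extModule φ L X (a + n)) := by
  obtain ⟨e⟩ := nonempty_extModule_equiv φ L (X⟦a⟧) n
  obtain ⟨e'⟩ := nonempty_extModule_equiv φ L X (a + n)
  have e'' : homotopyHom (baseChangeResolution φ L) (X⟦a⟧) n ≃ₗ[S]
      homotopyHom (baseChangeResolution φ L) X (a + n) :=
    Linear.homCongr S (Iso.refl _) ((CategoryTheory.shiftFunctor _ n).mapIso
      (((HomotopyCategory.quotient _ (ComplexShape.up ℤ)).commShiftIso a).app X) ≪≫
      ((CategoryTheory.shiftFunctorAdd _ a n).app _).symm)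
  exact (e.trans (e''.trans e'.symm)).length_eq

lemma length_extModule_mappingCone {X : CochainComplex (ModuleCat.{u} S) ℤ} {s : S}
    (hs : ∀ n, s ∈ Module.annihilator S (extModule φ L X n)) (n : ℤ) :
    Module.length S (extModule φ L (mappingCone (s • 𝟙 X)) n) =
      Module.length S (extModule φ L X n) + Module.length S (extModule φ L X (n + 1)) := by
  obtain ⟨e⟩ := nonempty_extModule_equiv φ L (mappingCone (s • 𝟙 X)) n
  obtain ⟨e'⟩ := nonempty_extModule_equiv φ L X n
  obtain ⟨e''⟩ := nonempty_extModule_equiv φ L X (n + 1)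
  rw [e.length_eq, e'.length_eq, e''.length_eq]
  refine length_homotopyHom_mappingCone _ _ _ (fun m f => ?_) n
  obtain ⟨d⟩ := nonempty_extModule_equiv φ L X m
  have h := hs m
  rw [d.annihilator_eq, Module.mem_annihilator] at h
  exact h f

lemma subsingleton_extModule {X : CochainComplex (ModuleCat.{u} S) ℤ} {b : ℤ}
    (hX : ∀ n < b, Subsingleton (X.homology n)) {n : ℤ} (hn : n < b) :
    Subsingleton (extModule φ L X n) := by
  obtain ⟨e⟩ := nonempty_extModule_equiv φ L X n
  have := subsingleton_homotopyHom (baseChangeResolution φ L) hX hn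
  exact e.injective.subsingleton

lemma finite_extModule [IsNoetherianRing R] [IsNoetherianRing S] [Module.Finite R L]
    {X : CochainComplex (ModuleCat.{u} S) ℤ} {b : ℤ} (hX : ∀ n < b, Subsingleton (X.homology n))
    (hf : ∀ n, Module.Finite S (X.homology n)) (n : ℤ) :
    Module.Finite S (extModule φ L X n) := by
  obtain ⟨e⟩ := nonempty_extModule_equiv φ L X n
  have : Module.Finite S (homotopyHom (baseChangeResolution φ L) X n) :=
    finite_homotopyHom_baseChange φ hX hf n (L := ModuleCat.of R L) (projectiveResolution _)
  exact Module.Finite.equiv e.symm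

/-- Injectivity of `E` moves `Hom(-, E)` inside the homology, and tensor-hom adjunction identifies
the resulting complex. -/
lemma nonempty_dual_torModule_equiv {E : Type u} [AddCommGroup E] [Module S E]
    (hE : Module.Injective S E) (X : CochainComplex (ModuleCat.{u} S) ℤ) (n : ℤ) :
    Nonempty ((torModule φ L X n →ₗ[S] E) ≃ₗ[S] extModule φ L (homToModule X E) n) := by
  have h : ∀ m : ℤ, m = n → Nonempty ((torModule φ L X n →ₗ[S] E) ≃ₗ[S]
      (homComplex (baseChangeResolution φ L) (homToModule X E)).homology m) := by
    rintro m rfl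
    exact ⟨(homologyHomToModuleEquiv hE _ m).symm.trans (HomologicalComplex.homologyMapIso
      (homToModuleTensorIso E (baseChangeResolution φ L) X) m).toLinearEquiv⟩
  exact h _ (neg_neg n)

lemma homotopyAnnihilator_le_annihilator_homology (X : CochainComplex (ModuleCat.{u} S) ℤ)
    (n : ℤ) : homotopyAnnihilator X ≤ Module.annihilator S (X.homology n) := by
  rintro s ⟨h, hh⟩
  have h1 : Homotopy (s • 𝟙 X) 0 := (Cochain.equivHomotopy _ _).symm ⟨h, by simp [hh]⟩
  have h2 := h1.homologyMap_eq n
  have h3 : HomologicalComplex.homologyMap (s • 𝟙 X) n = s • 𝟙 (X.homology n) :=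
    (ShortComplex.homologyMap_smul (𝟙 (X.sc n)) s).trans
      (congrArg (s • ·) (ShortComplex.homologyMap_id _))
  rw [HomologicalComplex.homologyMap_zero, h3] at h2
  rw [Module.mem_annihilator]
  exact fun a => ConcreteCategory.congr_hom h2 a

end ExtModules

/-! ### Ext from the residue field under Koszul complexes and their duals -/

section LocalRings

open CochainComplex CochainComplex.HomComplex IsLocalRing

variable {R S : Type u} [CommRing R] [CommRing S] [IsLocalRing R] (φ : R →+* S)

/-- The two summands act as zero for different reasons: `𝔪S` through the first argument `k`, the
homotopy annihilator through `X`. -/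
lemma le_annihilator_extModule {X : CochainComplex (ModuleCat.{u} S) ℤ} {I : Ideal S}
    (hX : I ≤ extendedIdeal φ ⊔ homotopyAnnihilator X) (n : ℤ) :
    I ≤ Module.annihilator S (extModule φ (ResidueField R) X n) := by
  refine hX.trans (sup_le (le_trans (Ideal.map_mono ?_)
    (map_annihilator_le_annihilator_extModule φ _ X n))
    (homotopyAnnihilator_le_annihilator_extModule φ _ X n))
  intro r hr
  rw [Module.mem_annihilator]
  intro a
  rw [Algebra.smul_def]
  have : algebraMap R (ResidueField R) r = 0 := (residue_eq_zero_iff r).mpr hr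
  rw [this, zero_mul]

/-- Homotopy annihilators only grow under further cones, so at each stage the next element still
kills Ext and contributes one `stepSum`. -/
lemma length_extModule_koszulList {X : CochainComplex (ModuleCat.{u} S) ℤ}
    {I : Ideal S} (hX : I ≤ extendedIdeal φ ⊔ homotopyAnnihilator X) {a : ℤ → ℕ}
    (ha : ∀ n, Module.length S (extModule φ (ResidueField R) X n) = a n) (l : List S)
    (hl : ∀ s ∈ l, s ∈ I) (n : ℤ) :
    Module.length S (extModule φ (ResidueField R) (koszulList X l) n) =
      (stepSum^[l.length] a n : ℕ) := by
  induction l generalizing n with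
  | nil => exact ha n
  | cons s l ih =>
    have ih' := ih fun t ht => hl t (List.mem_cons_of_mem _ ht)
    have h := le_annihilator_extModule φ
      (hX.trans (sup_le_sup_left (homotopyAnnihilator_le_koszulList X l) _))
    refine (length_extModule_mappingCone φ _ (fun m => h m (hl s List.mem_cons_self)) n).trans ?_
    rw [ih', ih', List.length_cons, Function.iterate_succ_apply', stepSum, Nat.cast_add]

/-- Dualizing turns each cone into a cocone, which is a cone shifted by `-1`; the argument is
therefore displaced by one for every element. -/
lemma length_extModule_homToModule_koszulList (E : Type u) [AddCommGroup E] [Module S E]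
    {A : CochainComplex (ModuleCat.{u} S) ℤ} {I : Ideal S} (hA : I ≤ homotopyAnnihilator A)
    {a : ℤ → ℕ} (ha : ∀ n, Module.length S (extModule φ (ResidueField R) (homToModule A E) n) = a n)
    (l : List S) (hl : ∀ s ∈ l, s ∈ I) (n : ℤ) :
    Module.length S (extModule φ (ResidueField R) (homToModule (koszulList A l) E) n) =
      (stepSum^[l.length] a (n - l.length) : ℕ) := by
  induction l generalizing n with
  | nil => rw [List.length_nil, Nat.cast_zero, sub_zero]; exact ha n
  | cons s l ih =>
    have ih' := ih fun t ht => hl t (List.mem_cons_of_mem _ ht)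
    have h := fun m => homotopyAnnihilator_le_annihilator_extModule φ (ResidueField R)
      (homToModule (koszulList A l) E) m (homotopyAnnihilator_le_homToModule E _
        (homotopyAnnihilator_le_koszulList A l (hA (hl s List.mem_cons_self))))
    refine (length_extModule_of_quasiIso φ _
      (homToModuleMappingConeIso E (koszulList A l) s).hom n).trans ?_
    refine (length_extModule_shift φ _ (mappingCone (s • 𝟙 (homToModule (koszulList A l) E)))
      (-1) n).trans ?_
    rw [length_extModule_mappingCone φ _ h, ih', ih', List.length_cons,
      Function.iterate_succ_apply', stepSum, Nat.cast_add]
    push_cast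
    rw [show -1 + n - (l.length : ℤ) = n - (l.length + 1) by ring,
      show -1 + n + 1 - (l.length : ℤ) = n - (l.length + 1) + 1 by ring]

lemma stepSum_iterate_sub (a : ℤ → ℕ) (c : ℤ) (d : ℕ) (n : ℤ) :
    stepSum^[d] (fun m => a (m - c)) n = stepSum^[d] a (n - c) := by
  induction d generalizing n with
  | zero => rfl
  | succ d ih =>
    rw [Function.iterate_succ_apply', Function.iterate_succ_apply', stepSum, stepSum, ih, ih]
    rw [show n + 1 - c = n - c + 1 by ring]

variable [IsLocalRing S] [IsLocalHom φ]

lemma mk_mem_maximalIdeal_iff (s : S) :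
    Ideal.Quotient.mk (extendedIdeal φ) s ∈ maximalIdeal (S ⧸ extendedIdeal φ) ↔
      s ∈ maximalIdeal S := by
  have h : ((maximalIdeal (S ⧸ extendedIdeal φ)).comap
      (Ideal.Quotient.mk (extendedIdeal φ))).IsMaximal :=
    Ideal.comap_isMaximal_of_surjective _ Ideal.Quotient.mk_surjective
  rw [← Ideal.mem_comap, eq_maximalIdeal h]

variable {φ} in
lemma IsMinimalGeneratingMod.mem_maximalIdeal {y : Fin (edimHom φ) → S}
    (hy : IsMinimalGeneratingMod φ y) (i : Fin (edimHom φ)) : y i ∈ maximalIdeal S := by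
  rw [← mk_mem_maximalIdeal_iff φ, ← show _ = _ from hy]
  exact Ideal.subset_span ⟨i, rfl⟩

variable {φ} in
lemma IsMinimalGeneratingMod.maximalIdeal_le {y : Fin (edimHom φ) → S}
    (hy : IsMinimalGeneratingMod φ y) :
    maximalIdeal S ≤ extendedIdeal φ ⊔ Ideal.span (Set.range y) := by
  intro s hs
  have h : Ideal.map (Ideal.Quotient.mk (extendedIdeal φ)) (Ideal.span (Set.range y)) =
      maximalIdeal (S ⧸ extendedIdeal φ) := by
    rw [Ideal.map_span, ← Set.range_comp]
    exact hy
  rw [← mk_mem_maximalIdeal_iff φ, ← h, ← Ideal.mem_comap, Ideal.comap_map_quotientMk] at hs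
  exact hs

end LocalRings

/-! ### Recovering Tor from its dual -/

section LocalRings

open IsLocalRing

variable {R S : Type u} [CommRing R] [CommRing S] [IsLocalRing S] (φ : R →+* S)

/-- `𝔫` kills the dual of Tor, hence Tor itself because `E` is a cogenerator; finite length of the
dual then makes Tor finite-dimensional of the same length. -/
lemma isFiniteResidueSpace_torModule {L : Type u} [AddCommGroup L] [Module R L] {E : Type u}
    [AddCommGroup E] [Module S E] {ι : ResidueField S →ₗ[S] E} (hE : IsInjectiveHull ι)
    {X : CochainComplex (ModuleCat.{u} S) ℤ} (hX : maximalIdeal S ≤ homotopyAnnihilator X) {n : ℤ}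
    (hn : Module.length S (extModule φ L (homToModule X E) n) ≠ ⊤) :
    IsFiniteResidueSpace (S := S) (torModule φ L X n) ∧
      Module.length S (torModule φ L X n) =
        Module.length S (extModule φ L (homToModule X E) n) := by
  obtain ⟨e⟩ := nonempty_dual_torModule_equiv φ L hE.injective_module X n
  have h1 : maximalIdeal S ≤ Module.annihilator S (torModule φ L X n →ₗ[S] E) := by
    rw [e.annihilator_eq]
    exact (hX.trans (homotopyAnnihilator_le_homToModule E X)).trans
      (homotopyAnnihilator_le_annihilator_extModule φ L _ n)
  have h2 : maximalIdeal S ≤ Module.annihilator S (torModule φ L X n) := by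
    intro s hs
    rw [Module.mem_annihilator]
    intro a
    by_contra ha
    obtain ⟨f, hf⟩ := exists_dual_apply_ne_zero hE ha
    exact hf (by rw [map_smul, ← LinearMap.smul_apply, Module.mem_annihilator.mp (h1 hs) f,
      LinearMap.zero_apply])
  rw [← e.length_eq] at hn ⊢
  have h3 : Module.Finite S (torModule φ L X n →ₗ[S] E) := by
    have := (isFiniteLength_iff_isNoetherian_isArtinian.mp (Module.length_ne_top_iff.mp hn)).1
    infer_instance
  have h4 : IsFiniteResidueSpace (S := S) (torModule φ L X n) :=
    ⟨finite_of_finite_dual hE h2 h3, h2⟩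
  exact ⟨h4, (finite_dual hE h4).1.symm⟩

lemma residueRank_eq_of_length_eq {V : Type u} [AddCommGroup V] [Module S V]
    (hV : IsFiniteResidueSpace (S := S) V) {n : ℕ} (h : Module.length S V = n) :
    residueRank (S := S) V = n := by
  rw [residueRank_eq_length V hV.2, h, ENat.toNat_natCast]

lemma length_eq_residueRank [IsNoetherianRing S] {V : Type u} [AddCommGroup V] [Module S V]
    (hV : IsFiniteResidueSpace (S := S) V) :
    Module.length S V = (residueRank (S := S) V : ℕ) := by
  rw [residueRank_eq_length V hV.2, ENat.natCast_toNat (length_ne_top_of_isFiniteResidueSpace hV)]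

end LocalRings

/-! ### Betti numbers of a dual complex -/

section LocalHom

open IsLocalRing

variable {R S : Type u} [CommRing R] [IsLocalRing R] [CommRing S] [IsNoetherianRing S]
  [IsLocalRing S] (φ : R →+* S)

lemma isFiniteResidueSpace_extModule [IsNoetherianRing R] {X : CochainComplex (ModuleCat.{u} S) ℤ} {b : ℤ}
    (hb : ∀ n < b, Subsingleton (X.homology n)) (hf : ∀ n, Module.Finite S (X.homology n))
    (hX : maximalIdeal S ≤ extendedIdeal φ ⊔ homotopyAnnihilator X) (n : ℤ) :
    IsFiniteResidueSpace (S := S) (extModule φ (ResidueField R) X n) :=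
  ⟨finite_extModule φ _ hb hf n, le_annihilator_extModule φ hX n⟩

variable [IsLocalHom φ] {E : Type u} [AddCommGroup E] [Module S E] {ι : ResidueField S →ₗ[S] E}

/-- The Betti numbers of `Hom(Z, E)` in terms of the ranks of `Ext(k, Z)`. -/
lemma bettiModule_homToModule (hE : IsInjectiveHull ι) {Z : CochainComplex (ModuleCat.{u} S) ℤ}
    (hZ : maximalIdeal S ≤ homotopyAnnihilator Z)
    (hf : ∀ n, Module.Finite S (Z.homology n)) {y : Fin (edimHom φ) → S}
    (hy : IsMinimalGeneratingMod φ y) {a : ℤ → ℕ}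
    (ha : ∀ n, Module.length S (extModule φ (ResidueField R) Z n) = a n) (n : ℤ) :
    IsFiniteResidueSpace (S := S) (bettiModule φ y (homToModule Z E) n) ∧
      betti φ y (homToModule Z E) n = stepSum^[edimHom φ] a (n - edimHom φ) := by
  have hN := hZ.trans (homotopyAnnihilator_le_homToModule E Z)
  have hbi : ∀ n, Module.length S (extModule φ (ResidueField R)
      (homToModule (homToModule Z E) E) n) = a n := fun n => by
    have := biduality_quasiIso hE Z fun n =>
      ⟨hf n, hZ.trans (homotopyAnnihilator_le_annihilator_homology Z n)⟩
    rw [← length_extModule_of_quasiIso φ _ (biduality E Z), ha]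
  have h := length_extModule_homToModule_koszulList φ E hN hbi (List.ofFn y)
    (fun s hs => by
      obtain ⟨i, rfl⟩ := (List.mem_ofFn' y s).mp hs
      exact hy.mem_maximalIdeal i) n
  rw [List.length_ofFn] at h
  obtain ⟨h1, h2⟩ := isFiniteResidueSpace_torModule φ (L := ResidueField R) (n := n) hE
    (X := koszul y (homToModule Z E)) (hN.trans (homotopyAnnihilator_le_koszulList _ _))
    (h.trans_ne (ENat.natCast_ne_top _))
  exact ⟨h1, residueRank_eq_of_length_eq h1 (h2.trans h)⟩

end LocalHom

end LocalHomInvariants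

/-! ### The proposition -/

open LocalHomInvariants in
theorem proposition3p1 {R S : Type u} [CommRing R] [IsNoetherianRing R] [IsLocalRing R]
    [CommRing S] [IsNoetherianRing S] [IsLocalRing S] (φ : R →+* S) [IsLocalHom φ]
    (E : Type u) [AddCommGroup E] [Module S E] (ι : IsLocalRing.ResidueField S →ₗ[S] E)
    (hE : IsInjectiveHull ι)
    (M : CochainComplex (ModuleCat.{u} S) ℤ) (hM : InDMinus M)
    (x : Fin (edim S) → S) (hx : IsMinimalGenerating x)
    (y : Fin (edimHom φ) → S) (hy : IsMinimalGeneratingMod φ y)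
    (z : Fin (edimHom φ) → S) (hz : IsMinimalGeneratingMod φ z) :
    InDPlus (homToModule (koszul x M) E) ∧
    (∀ n, IsFiniteResidueSpace (S := S) (bettiModule φ y (homToModule (koszul x M) E) n)) ∧
    (∀ n, IsFiniteResidueSpace (S := S) (bassModule φ z M n)) ∧
    (∃ (hP : BddBelow (Function.support (betti φ y (homToModule (koszul x M) E))))
        (hI : BddBelow (Function.support (bass φ z M))),
      laurent (betti φ y (homToModule (koszul x M) E)) hP =
        laurent (bass φ z M) hI * (1 + HahnSeries.single (-1 : ℤ) (1 : ℤ)) ^ edim S) ∧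
    curv (betti φ y (homToModule (koszul x M) E)) = curv (bass φ z M) ∧
    cx (betti φ y (homToModule (koszul x M) E)) = cx (bass φ z M) := by
  obtain ⟨hMf, b, hMb⟩ := hM
  have hf : ∀ n, Module.Finite S (M.homology n) := fun n =>
    neg_neg n ▸ hMf (-n)
  have hb : ∀ n < -b, Subsingleton (M.homology n) := fun n hn =>
    neg_neg n ▸ hMb (-n) (by omega)
  have hZ : IsLocalRing.maximalIdeal S ≤ homotopyAnnihilator (koszul x M) :=
    (show _ = _ from hx) ▸ span_le_homotopyAnnihilator_koszul M x
  have hZf : ∀ n, Module.Finite S ((koszul x M).homology n) := finite_homology_koszulList hf _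
  obtain ⟨c, hc⟩ : ∃ c, ∀ n < c, Subsingleton ((koszul x M).homology n) :=
    subsingleton_homology_koszulList hb _
  have hzf : ∀ n, Module.Finite S ((koszul z M).homology n) := finite_homology_koszulList hf _
  obtain ⟨d, hd⟩ : ∃ d, ∀ n < d, Subsingleton ((koszul z M).homology n) :=
    subsingleton_homology_koszulList hb _
  have hzM : IsLocalRing.maximalIdeal S ≤ extendedIdeal φ ⊔ homotopyAnnihilator (koszul z M) :=
    hz.maximalIdeal_le.trans (sup_le_sup_left (span_le_homotopyAnnihilator_koszul M z) _)
  have hx_mem : ∀ s ∈ List.ofFn x, s ∈ IsLocalRing.maximalIdeal S := fun s hs => by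
    obtain ⟨i, rfl⟩ := (List.mem_ofFn' x s).mp hs
    rw [← show _ = _ from hx]
    exact Ideal.subset_span ⟨i, rfl⟩
  have hz_mem : ∀ s ∈ List.ofFn z, s ∈ IsLocalRing.maximalIdeal S := fun s hs => by
    obtain ⟨i, rfl⟩ := (List.mem_ofFn' z s).mp hs
    exact hz.mem_maximalIdeal i
  have hExtZ := isFiniteResidueSpace_extModule φ hc hZf (hZ.trans le_sup_right)
  have hExtM := isFiniteResidueSpace_extModule φ hd hzf hzM
  have hbetti := bettiModule_homToModule φ hE hZ hZf hy fun n => length_eq_residueRank (hExtZ n)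
  -- Both sides are the length of `Ext^n(k, -)` on the Koszul complex of `M` over `x` and `z`
  -- together, built in the two possible orders.
  have key : ∀ n, stepSum^[edimHom φ] (fun n => residueRank (S := S)
        (extModule φ (IsLocalRing.ResidueField R) (koszul x M) n)) n =
      stepSum^[edim S] (fun n => residueRank (S := S)
        (extModule φ (IsLocalRing.ResidueField R) (koszul z M) n)) n := fun n => by
    have h1 := length_extModule_koszulList φ (hZ.trans le_sup_right)
      (fun n => length_eq_residueRank (hExtZ n)) _ hz_mem n
    have h2 := length_extModule_koszulList φ hzM
      (fun n => length_eq_residueRank (hExtM n)) _ hx_mem n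
    obtain ⟨e⟩ := nonempty_koszul_koszul_iso M z x
    have h3 := length_extModule_of_quasiIso φ (IsLocalRing.ResidueField R) e.hom n
    rw [List.length_ofFn] at h1 h2
    exact ENat.natCast_inj.mp (h1.symm.trans (h3.trans h2))
  have hfun : betti φ y (homToModule (koszul x M) E) = stepSum^[edim S] (bass φ z M) := by
    funext n
    -- The displacement by `edim φ` caused by dualizing `K[y; -]` is exactly the one built into the
    -- definition of Bass numbers.
    rw [(hbetti n).2, key, ← stepSum_iterate_sub]
    rfl
  have hI : BddBelow (Function.support (bass φ z M)) :=
    support_bddBelow_of_forall_lt (b := d + edimHom φ) fun n hn => by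
      have := subsingleton_extModule φ (IsLocalRing.ResidueField R) hd
        (n := n - edimHom φ) (by omega)
      refine residueRank_eq_of_length_eq (hExtM _) ?_
      rw [Nat.cast_zero, Module.length_eq_zero_iff]
      exact this
  refine ⟨⟨fun n => ?_, c, fun n hn => ?_⟩, fun n => (hbetti n).1, fun n => hExtM _, ?_, ?_, ?_⟩
  · have e := homologyHomToModuleEquiv hE.injective_module (koszul x M) (-n)
    have := (finite_dual hE ⟨hZf (-(-n)),
      hZ.trans (homotopyAnnihilator_le_annihilator_homology _ _)⟩).2.1
    exact Module.Finite.equiv e.symm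
  · have e := homologyHomToModuleEquiv hE.injective_module (koszul x M) (-n)
    have := hc (-(-n)) (by omega)
    exact e.injective.subsingleton
  · obtain ⟨hP, h⟩ := laurent_stepSum_iterate (edim S) hI
    exact ⟨hfun ▸ hP, hI, by simpa only [hfun] using h⟩
  · rw [hfun, curv_stepSum_iterate]
  · rw [hfun, cx_stepSum_iterate]
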